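/- **Corollary 4.13 (separable categoricity of completions of $Pr$).** Work in $[0,1]$-valued continuous first-order logic (connectives: all continuous functions $[0,1]^k\to[0,1]$; quantifiers $\sup$, $\inf$). Let $L^{pr}$ be the signature with constants $0,1$, a unary function symbol $\cdot^c$, binary function symbols $\cap,\cup$, a unary predicate symbol $\mu$ and the metric $d$, where $\cdot^c$ and $\mu$ have modulus of uniform continuity $\Delta(\varepsilon)=\varepsilon$, and $\cap,\cup$ have modulus $\Delta(\varepsilon)=\varepsilon/2$. An $L^{pr}$-structure is a complete metric space of diameter at most $1$ with interpretations of these symbols respecting the moduli. Let $Pr$ be the $L^{pr}$-theory consisting of the axioms of Boolean algebras (each written as a condition $\sup_{\bar x} d(t(\bar x),s(\bar x))=0$), together with $\mu(0)=0$, $\mu(1)=1$, the axioms saying that $\mu(x\cap y)\le\mu(x)\le\mu(x\cup y)$ and $\mu(x)-\mu(x\cap y)=\mu(x\cup y)-\mu(y)$ for all $x,y$, and $d(x,y)=\mu(x\mathbin{\triangle}y)$ for all $x,y$. (Its models are the probability algebras.) A completion of $Pr$ is an $L^{pr}$-theory $T\supseteq Pr$ that has a model and all of whose models are elementarily equivalent.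 Let $T$ be a completion of $Pr$. Then: 1. $T$ is separably categorical: $T$ has a separable model, and any two separable models of $T$ are isomorphic. 2. The unique separable model $\mathcal M$ of $T$ is strongly $\omega$-homogeneous: if $n\ge 0$ and $a,b\in M^n$ satisfy $\varphi^{\mathcal M}(a)=\varphi^{\mathcal M}(b)$ for every $L^{pr}$-formula $\varphi(x_1,\dots,x_n)$, then some automorphism of $\mathcal M$ maps $a_i$ to $b_i$ for all $i$. 3. Every model $\mathcal M$ of $T$, separable or not, is $\omega$-saturated: for every finite tuple $a$ in $M$ and every set $\Gamma(x)$ of conditions $\varphi(a,x)=0$, where $x=(x_1,\dots,x_n)$ is a finite tuple of variables and the $\varphi$ are $L^{pr}$-formulas, if for every finite $\Gamma_0\subseteq\Gamma$ and every $\varepsilon>0$ there is $b\in M^n$ with $\varphi^{\mathcal M}(a,b)\le\varepsilon$ for all conditions $\varphi(a,x)=0$ in $\Gamma_0$, then some $b\in M^n$ satisfies every condition in $\Gamma$. -/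

import Mathlib

open scoped unitInterval

universe u v

/-! Continuous first-order logic for the signature of probability algebras. -/

/-- A (metric) structure for the signature `(0, 1, ·ᶜ, ∩, ∪, μ, d)`: a complete metric space of
diameter at most `1` with interpretations of the symbols, where `·ᶜ` and `μ` have modulus of
uniform continuity `Δ(ε) = ε` and `∩`, `∪` have modulus `Δ(ε) = ε / 2`. -/
class PrStructure (M : Type u) extends MetricSpace M where
  complete : CompleteSpace M
  dist_le_one : ∀ a b : M, dist a b ≤ 1
  zero : M
  one : M
  compl : M → M
  inter : M → M → M
  union : M → M → M
  mu : M → I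
  compl_modulus : ∀ ε : ℝ, 0 < ε → ε ≤ 1 → ∀ a b : M, dist a b < ε →
    dist (compl a) (compl b) ≤ ε
  inter_modulus : ∀ ε : ℝ, 0 < ε → ε ≤ 1 → ∀ a b a' b' : M,
    dist a a' < ε / 2 → dist b b' < ε / 2 → dist (inter a b) (inter a' b') ≤ ε
  union_modulus : ∀ ε : ℝ, 0 < ε → ε ≤ 1 → ∀ a b a' b' : M,
    dist a a' < ε / 2 → dist b b' < ε / 2 → dist (union a b) (union a' b') ≤ ε
  mu_modulus : ∀ ε : ℝ, 0 < ε → ε ≤ 1 → ∀ a b : M, dist a b < ε →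
    |(mu a : ℝ) - (mu b : ℝ)| ≤ ε

/-- Terms in the variables `x₀, …, xₙ₋₁`. -/
inductive PrTerm (n : ℕ) : Type
  | var : Fin n → PrTerm n
  | zero : PrTerm n
  | one : PrTerm n
  | compl : PrTerm n → PrTerm n
  | inter : PrTerm n → PrTerm n → PrTerm n
  | union : PrTerm n → PrTerm n → PrTerm n

/-- Formulas of continuous logic with free variables among `x₀, …, xₙ₋₁`. The connectives are all
continuous functions `[0,1]ᵏ → [0,1]`; the quantifiers `sup` and `inf` bind the last variable. -/
inductive PrFormula : ℕ → Type
  | mu {n : ℕ} (t : PrTerm n) : PrFormula n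
  | d {n : ℕ} (t s : PrTerm n) : PrFormula n
  | conn {n k : ℕ} (f : C(Fin k → I, I)) (φ : Fin k → PrFormula n) : PrFormula n
  | sup {n : ℕ} (φ : PrFormula (n + 1)) : PrFormula n
  | inf {n : ℕ} (φ : PrFormula (n + 1)) : PrFormula n

/-- Sentences: formulas without free variables. -/
abbrev PrSentence : Type := PrFormula 0

/-- The value of a term at a tuple. -/
def PrTerm.eval {M : Type u} [PrStructure M] {n : ℕ} : PrTerm n → (Fin n → M) → M
  | .var i, a => a i
  | .zero, _ => PrStructure.zero
  | .one, _ => PrStructure.one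
  | .compl t, a => PrStructure.compl (t.eval a)
  | .inter t s, a => PrStructure.inter (t.eval a) (s.eval a)
  | .union t s, a => PrStructure.union (t.eval a) (s.eval a)

/-- The value in `[0,1]` of a formula at a tuple. -/
noncomputable def PrFormula.eval {M : Type u} [PrStructure M] :
    {n : ℕ} → PrFormula n → (Fin n → M) → I
  | _, .mu t, a => PrStructure.mu (t.eval a)
  | _, .d t s, a =>
      ⟨dist (t.eval a) (s.eval a), dist_nonneg, PrStructure.dist_le_one _ _⟩
  | _, .conn f φ, a => f fun i => (φ i).eval a
  | _, .sup φ, a => ⨆ b : M, φ.eval (Fin.snoc a b)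
  | _, .inf φ, a => ⨅ b : M, φ.eval (Fin.snoc a b)

/-- A theory is a set of closed conditions; the sentence `φ` stands for the condition `φ = 0`. -/
abbrev PrTheory : Type := Set PrSentence

/-- `M` is a model of `T`: all conditions `φ = 0` in `T` are true in `M`. -/
def IsModel (M : Type u) [PrStructure M] (T : PrTheory) : Prop :=
  ∀ φ ∈ T, φ.eval (Fin.elim0 : Fin 0 → M) = 0

/-- Elementary equivalence: all sentences have the same value. -/
def ElemEquiv (M : Type u) (N : Type v) [PrStructure M] [PrStructure N] : Prop :=
  ∀ φ : PrSentence, φ.eval (Fin.elim0 : Fin 0 → M) = φ.eval (Fin.elim0 : Fin 0 → N)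

/-- A theory is complete if it has a model and all its models are elementarily equivalent. -/
def IsCompleteTheory (T : PrTheory) : Prop :=
  (∃ (M : Type u) (_ : PrStructure M), IsModel M T) ∧
  ∀ (M N : Type u) [PrStructure M] [PrStructure N], IsModel M T → IsModel N T → ElemEquiv M N

/-- A completion of `T₀` is a complete theory (in the same signature) extending `T₀`. -/
def IsCompletion (T₀ T : PrTheory) : Prop :=
  T₀ ⊆ T ∧ IsCompleteTheory.{u} T

/-! The axioms of probability algebras. -/

/-- Truncated subtraction `x ∸ y` as a connective. -/
noncomputable def connTsub : C(Fin 2 → I, I) where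
  toFun x := ⟨max ((x 0 : ℝ) - x 1) 0,
    le_max_right _ _, max_le (by linarith [(x 0).2.2, (x 1).2.1]) zero_le_one⟩
  continuous_toFun := by fun_prop

/-- The connective `|x - y|`. -/
noncomputable def connAbs : C(Fin 2 → I, I) where
  toFun x := ⟨|(x 0 : ℝ) - x 1|, abs_nonneg _, abs_le.2
    ⟨by linarith [(x 0).2.1, (x 1).2.2], by linarith [(x 0).2.2, (x 1).2.1]⟩⟩
  continuous_toFun := by fun_prop

namespace PrFormula

/-- The formula `φ ∸ ψ`. -/
noncomputable def tsub {n : ℕ} (φ ψ : PrFormula n) : PrFormula n := conn connTsub ![φ, ψ]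

/-- The formula `|φ - ψ|`. -/
noncomputable def absDiff {n : ℕ} (φ ψ : PrFormula n) : PrFormula n := conn connAbs ![φ, ψ]

/-- The constant formula with value `1`. -/
noncomputable def oneConst {n : ℕ} : PrFormula n :=
  conn (ContinuousMap.const (Fin 0 → I) 1) Fin.elim0

end PrFormula

/-- The term `x Δ y = (x ∩ yᶜ) ∪ (xᶜ ∩ y)`. -/
def PrTerm.symmDiff {n : ℕ} (t s : PrTerm n) : PrTerm n :=
  .union (.inter t (.compl s)) (.inter (.compl t) s)

section Axioms

open PrTerm PrFormula

/-- The axioms for Boolean algebras, as universal closures of equations. -/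
def booleanAxioms : PrTheory :=
  { sup (sup (d (union (var 0) (var 1)) (union (var 1) (var 0)))),
    sup (sup (d (inter (var 0) (var 1)) (inter (var 1) (var 0)))),
    sup (sup (sup (d (union (var 0) (union (var 1) (var 2)))
      (union (union (var 0) (var 1)) (var 2))))),
    sup (sup (sup (d (inter (var 0) (inter (var 1) (var 2)))
      (inter (inter (var 0) (var 1)) (var 2))))),
    sup (sup (d (union (var 0) (inter (var 0) (var 1))) (var 0))),
    sup (sup (d (inter (var 0) (union (var 0) (var 1))) (var 0))),
    sup (sup (sup (d (inter (var 0) (union (var 1) (var 2)))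
      (union (inter (var 0) (var 1)) (inter (var 0) (var 2)))))),
    sup (sup (sup (d (union (var 0) (inter (var 1) (var 2)))
      (inter (union (var 0) (var 1)) (union (var 0) (var 2)))))),
    sup (d (union (var 0) zero) (var 0)),
    sup (d (inter (var 0) one) (var 0)),
    sup (d (union (var 0) (compl (var 0))) one),
    sup (d (inter (var 0) (compl (var 0))) zero) }

/-- The measure axioms. -/
def measureAxioms : PrTheory :=
  { mu zero,
    absDiff (mu one) oneConst,
    sup (sup (tsub (mu (inter (var 0) (var 1))) (mu (var 0)))),
    sup (sup (tsub (mu (var 0)) (mu (union (var 0) (var 1))))),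
    sup (sup (absDiff
      (tsub (mu (var 0)) (mu (inter (var 0) (var 1))))
      (tsub (mu (union (var 0) (var 1))) (mu (var 1))))) }

/-- The condition `sup_x sup_y |d(x, y) - μ(x Δ y)| = 0`. -/
def metricAxioms : PrTheory :=
  { sup (sup (absDiff (d (var 0) (var 1)) (mu (symmDiff (var 0) (var 1))))) }

/-- The theory of probability algebras. -/
def Pr : PrTheory := booleanAxioms ∪ measureAxioms ∪ metricAxioms

end Axioms

/-! Model-theoretic notions. -/

/-- An isomorphism of structures: a bijection that preserves all symbols, the metric included. -/
structure PrIso (M : Type u) (N : Type v) [PrStructure M] [PrStructure N] extends M ≃ N where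
  map_zero : toFun PrStructure.zero = PrStructure.zero
  map_one : toFun PrStructure.one = PrStructure.one
  map_compl : ∀ a, toFun (PrStructure.compl a) = PrStructure.compl (toFun a)
  map_inter : ∀ a b, toFun (PrStructure.inter a b) = PrStructure.inter (toFun a) (toFun b)
  map_union : ∀ a b, toFun (PrStructure.union a b) = PrStructure.union (toFun a) (toFun b)
  map_mu : ∀ a, PrStructure.mu (toFun a) = PrStructure.mu a
  map_dist : ∀ a b, dist (toFun a) (toFun b) = dist a b

/-- `T` is separably categorical: up to isomorphism it has exactly one separable model. -/
def IsSeparablyCategorical (T : PrTheory) : Prop :=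
  (∃ (M : Type u) (_ : PrStructure M), IsModel M T ∧ TopologicalSpace.SeparableSpace M) ∧
  ∀ (M N : Type u) [PrStructure M] [PrStructure N], IsModel M T → IsModel N T →
    TopologicalSpace.SeparableSpace M → TopologicalSpace.SeparableSpace N → Nonempty (PrIso M N)

/-- The finite tuples `a` and `b` of elements of `M` have the same type in `M`; in other words,
`aᵢ ↦ bᵢ` is a (well defined) elementary map. -/
def SameType {M : Type u} [PrStructure M] {n : ℕ} (a b : Fin n → M) : Prop :=
  ∀ φ : PrFormula n, φ.eval a = φ.eval b

/-- `M` is strongly `ω`-homogeneous: every elementary map between finite subsets of `M` extends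
to an automorphism of `M`. -/
def IsStronglyOmegaHomogeneous (M : Type u) [PrStructure M] : Prop :=
  ∀ (n : ℕ) (a b : Fin n → M), SameType a b → ∃ g : PrIso M M, ∀ i, g.toFun (a i) = b i

/-- `M` is `ω`-saturated: for every finite tuple `a` of parameters in `M`, every set `Γ` of
conditions `φ(a, x) = 0` in finitely many variables `x` that is finitely approximately satisfiable
in `M` is satisfied by some tuple in `M`. -/
def IsOmegaSaturated (M : Type u) [PrStructure M] : Prop :=
  ∀ (m n : ℕ) (a : Fin m → M) (Γ : Set (PrFormula (m + n))),
    (∀ Γ₀ : Finset (PrFormula (m + n)), (Γ₀ : Set (PrFormula (m + n))) ⊆ Γ → ∀ ε : ℝ, 0 < ε →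
      ∃ x : Fin n → M, ∀ φ ∈ Γ₀, (φ.eval (Fin.append a x) : ℝ) ≤ ε) →
    ∃ x : Fin n → M, ∀ φ ∈ Γ, φ.eval (Fin.append a x) = 0

/-! A model of `Pr` is a complete Boolean algebra with a strictly positive measure. It has countably
many atoms, and the complement `cont M` of their join is atomless. A finite tuple cuts the algebra
into cells. `Rel` compares two tuples cell by cell: equal measure, and a measure-preserving
bijection between the atoms below.

`Rel` is a back-and-forth system between arbitrary models, with no separability or saturation needed
(`SameProfile.split`, `Rel.extend`): to copy a piece of a cell, transport its atoms along the
bijection and cut a piece of the right measure from the atomless part. Hence related tuples satisfy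
the same formulas (`Rel.eval_eq`). Conversely, formulas can read off the measures of atoms: an
element that cannot be split nearly in half contains a large atom, and iterating this counts the
atoms above each threshold (`lt_level_iff`, `rel_of_eval_eq`). So `Rel` is equality of types.

In separable models, back-and-forth along dense sequences turns `Rel` into an isomorphism
(`Rel.exists_prIso`); this gives uniqueness and homogeneity. A separable model exists because the
atoms and a path through the atomless part generate a separable closed subalgebra with the same
atoms (`exists_separable_rel`). For saturation, over a tuple every element is related to one in a
fixed compact set (`exists_isCompact_rel`), so one-variable types are realized by compactness and
further variables follow by induction. -/

/-- The structures that are models of `Pr`, described by equations between elements. -/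
class IsProbAlg (M : Type u) [PrStructure M] : Prop where
  union_comm : ∀ a b : M, PrStructure.union a b = PrStructure.union b a
  inter_comm : ∀ a b : M, PrStructure.inter a b = PrStructure.inter b a
  union_assoc : ∀ a b c : M, PrStructure.union a (PrStructure.union b c) =
    PrStructure.union (PrStructure.union a b) c
  inter_assoc : ∀ a b c : M, PrStructure.inter a (PrStructure.inter b c) =
    PrStructure.inter (PrStructure.inter a b) c
  union_absorb : ∀ a b : M, PrStructure.union a (PrStructure.inter a b) = a
  inter_absorb : ∀ a b : M, PrStructure.inter a (PrStructure.union a b) = a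
  inter_union : ∀ a b c : M, PrStructure.inter a (PrStructure.union b c) =
    PrStructure.union (PrStructure.inter a b) (PrStructure.inter a c)
  union_inter : ∀ a b c : M, PrStructure.union a (PrStructure.inter b c) =
    PrStructure.inter (PrStructure.union a b) (PrStructure.union a c)
  union_zero : ∀ a : M, PrStructure.union a PrStructure.zero = a
  inter_one : ∀ a : M, PrStructure.inter a PrStructure.one = a
  union_compl : ∀ a : M, PrStructure.union a (PrStructure.compl a) = PrStructure.one
  inter_compl : ∀ a : M, PrStructure.inter a (PrStructure.compl a) = PrStructure.zero
  mu_zero : PrStructure.mu (PrStructure.zero : M) = 0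
  mu_one : PrStructure.mu (PrStructure.one : M) = 1
  mu_inter_le : ∀ a b : M, PrStructure.mu (PrStructure.inter a b) ≤ PrStructure.mu a
  le_mu_union : ∀ a b : M, PrStructure.mu a ≤ PrStructure.mu (PrStructure.union a b)
  mu_modular : ∀ a b : M,
    (PrStructure.mu a : ℝ) - PrStructure.mu (PrStructure.inter a b) =
      PrStructure.mu (PrStructure.union a b) - PrStructure.mu b
  dist_eq : ∀ a b : M, dist a b = PrStructure.mu (PrStructure.union
    (PrStructure.inter a (PrStructure.compl b)) (PrStructure.inter (PrStructure.compl a) b))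

/-! ### From the axioms to equations between elements -/

section Axioms

variable {M : Type u} [PrStructure M]

theorem PrFormula.eval_sup_eq_zero {n : ℕ} (φ : PrFormula (n + 1)) (a : Fin n → M) :
    (PrFormula.sup φ).eval a = 0 ↔ ∀ b : M, φ.eval (Fin.snoc a b) = 0 := by
  change (⨆ b : M, φ.eval (Fin.snoc a b)) = ⊥ ↔ _
  rw [iSup_eq_bot]
  rfl

theorem PrFormula.eval_d_eq_zero {n : ℕ} (t s : PrTerm n) (a : Fin n → M) :
    (PrFormula.d t s).eval a = 0 ↔ t.eval a = s.eval a := by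
  rw [← dist_eq_zero (x := t.eval a), Subtype.ext_iff]
  rfl

theorem PrFormula.eval_tsub_coe {n : ℕ} (φ ψ : PrFormula n) (a : Fin n → M) :
    ((PrFormula.tsub φ ψ).eval a : ℝ) = max ((φ.eval a : ℝ) - ψ.eval a) 0 := rfl

theorem PrFormula.eval_absDiff_eq_zero {n : ℕ} (φ ψ : PrFormula n) (a : Fin n → M) :
    (PrFormula.absDiff φ ψ).eval a = 0 ↔ φ.eval a = ψ.eval a := by
  rw [Subtype.ext_iff, Subtype.ext_iff, ← sub_eq_zero (a := (φ.eval a : ℝ)), ← abs_eq_zero]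
  rfl

theorem PrFormula.eval_tsub_eq_zero {n : ℕ} (φ ψ : PrFormula n) (a : Fin n → M) :
    (PrFormula.tsub φ ψ).eval a = 0 ↔ φ.eval a ≤ ψ.eval a := by
  rw [Subtype.ext_iff, PrFormula.eval_tsub_coe]
  simp

theorem IsModel.isProbAlg (h : IsModel M Pr) : IsProbAlg M := by
  have hB : ∀ φ ∈ booleanAxioms, φ.eval (Fin.elim0 : Fin 0 → M) = 0 :=
    fun φ hφ => h φ (Or.inl (Or.inl hφ))
  have hM : ∀ φ ∈ measureAxioms, φ.eval (Fin.elim0 : Fin 0 → M) = 0 :=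
    fun φ hφ => h φ (Or.inl (Or.inr hφ))
  have hD : ∀ φ ∈ metricAxioms, φ.eval (Fin.elim0 : Fin 0 → M) = 0 :=
    fun φ hφ => h φ (Or.inr hφ)
  simp only [booleanAxioms, Set.mem_insert_iff, Set.mem_singleton_iff, forall_eq_or_imp,
    forall_eq, PrFormula.eval_sup_eq_zero, PrFormula.eval_d_eq_zero] at hB
  simp only [measureAxioms, Set.mem_insert_iff, Set.mem_singleton_iff, forall_eq_or_imp,
    forall_eq, PrFormula.eval_sup_eq_zero, PrFormula.eval_absDiff_eq_zero,
    PrFormula.eval_tsub_eq_zero] at hM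
  simp only [metricAxioms, Set.mem_singleton_iff, forall_eq, PrFormula.eval_sup_eq_zero,
    PrFormula.eval_absDiff_eq_zero] at hD
  obtain ⟨b1, b2, b3, b4, b5, b6, b7, b8, b9, b10, b11, b12⟩ := hB
  obtain ⟨m1, m2, m3, m4, m5⟩ := hM
  refine ⟨b1, b2, b3, b4, b5, b6, b7, b8, b9, b10, b11, b12, m1, m2, m3, m4, fun a b => ?_,
    fun a b => congrArg Subtype.val (hD a b)⟩
  -- The axiom uses truncated subtraction; by monotonicity both differences are nonnegative, so the
  -- truncation has no effect.
  have h5 := congrArg Subtype.val (m5 a b)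
  have h3 : (PrStructure.mu (PrStructure.inter a b) : ℝ) ≤ PrStructure.mu a := m3 a b
  have h4 : (PrStructure.mu b : ℝ) ≤ PrStructure.mu (PrStructure.union a b) := by
    have := m4 b a
    have h1 : PrStructure.union b a = PrStructure.union a b := b1 b a
    rw [← h1]; exact this
  exact (max_eq_left (sub_nonneg.2 h3)).symm.trans (h5.trans (max_eq_left (sub_nonneg.2 h4)))

end Axioms

/-! ### The Boolean algebra, its measure and its completeness -/

namespace ProbAlg

section Measure

variable {M : Type u} [PrStructure M]

/-- The measure as a real number. -/
noncomputable def m (a : M) : ℝ := PrStructure.mu a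

theorem coe_mu (a : M) : (PrStructure.mu a : ℝ) = m a := rfl

theorem m_nonneg (a : M) : 0 ≤ m a := (PrStructure.mu a).2.1
theorem m_le_one (a : M) : m a ≤ 1 := (PrStructure.mu a).2.2

theorem mu_eq_mu_iff {N : Type v} [PrStructure N] {a : M} {b : N} :
    PrStructure.mu a = PrStructure.mu b ↔ m a = m b := Subtype.ext_iff

end Measure

section BooleanAlgebra

variable {M : Type u} [PrStructure M] [IsProbAlg M]

/-- The lattice operations are definitionally the symbols of the signature, so axioms and term
values transfer by unfolding. -/
noncomputable instance : BooleanAlgebra M :=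
  let _ : Max M := ⟨PrStructure.union⟩
  let _ : Min M := ⟨PrStructure.inter⟩
  let L : Lattice M := Lattice.mk' IsProbAlg.union_comm
    (fun a b c => (IsProbAlg.union_assoc a b c).symm) IsProbAlg.inter_comm
    (fun a b c => (IsProbAlg.inter_assoc a b c).symm)
    IsProbAlg.union_absorb IsProbAlg.inter_absorb
  { L with
    le_sup_inf := fun a b c => (IsProbAlg.union_inter a b c).symm.le
    compl := PrStructure.compl
    top := PrStructure.one
    bot := PrStructure.zero
    inf_compl_le_bot := fun a => (IsProbAlg.inter_compl a).le
    top_le_sup_compl := fun a => (IsProbAlg.union_compl a).symm.le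
    le_top := fun a => inf_eq_left.1 (IsProbAlg.inter_one a)
    bot_le := fun a => sup_eq_left.1 (IsProbAlg.union_zero a) }

@[simp] theorem m_bot : m (⊥ : M) = 0 := congrArg Subtype.val IsProbAlg.mu_zero
@[simp] theorem m_top : m (⊤ : M) = 1 := congrArg Subtype.val IsProbAlg.mu_one

theorem m_mono {a b : M} (h : a ≤ b) : m a ≤ m b := by
  have : m (b ⊓ a) ≤ m b := IsProbAlg.mu_inter_le b a
  rwa [inf_eq_right.2 h] at this

theorem m_sup_add_m_inf (a b : M) : m (a ⊔ b) + m (a ⊓ b) = m a + m b := by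
  have : m a - m (a ⊓ b) = m (a ⊔ b) - m b := IsProbAlg.mu_modular a b
  linarith

theorem m_sup_of_disjoint {a b : M} (h : Disjoint a b) : m (a ⊔ b) = m a + m b := by
  rw [← m_sup_add_m_inf, h.eq_bot, m_bot, add_zero]

theorem m_sup_le (a b : M) : m (a ⊔ b) ≤ m a + m b := by
  linarith [m_sup_add_m_inf a b, m_nonneg (a ⊓ b)]

theorem m_inf_add_m_sdiff (a b : M) : m (a ⊓ b) + m (a \ b) = m a := by
  rw [← m_sup_of_disjoint disjoint_inf_sdiff, sup_inf_sdiff]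

theorem m_sdiff_of_le {a b : M} (h : b ≤ a) : m (a \ b) = m a - m b := by
  have := m_inf_add_m_sdiff a b
  rw [inf_eq_right.2 h] at this
  linarith

theorem dist_eq_m (a b : M) : dist a b = m (symmDiff a b) := by
  rw [IsProbAlg.dist_eq, symmDiff_eq, inf_comm b]
  rfl

theorem dist_of_le {a b : M} (h : a ≤ b) : dist a b = m b - m a := by
  rw [dist_eq_m, symmDiff_of_le h, m_sdiff_of_le h]

theorem dist_bot_left (a : M) : dist ⊥ a = m a := by
  rw [dist_of_le bot_le, m_bot, sub_zero]

theorem eq_bot_of_m_eq_zero {a : M} (h : m a = 0) : a = ⊥ :=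
  (dist_eq_zero.1 ((dist_bot_left a).trans h)).symm

theorem m_pos {a : M} (h : a ≠ ⊥) : 0 < m a :=
  (m_nonneg a).lt_of_ne fun h' => h (eq_bot_of_m_eq_zero h'.symm)

/-- Strict positivity of the measure, which comes from `dist` being a metric: comparable elements
are equal once their measures agree. -/
theorem eq_of_le_of_m_le {a b : M} (h : a ≤ b) (h' : m b ≤ m a) : a = b :=
  dist_eq_zero.1 (le_antisymm (by rw [dist_of_le h]; linarith) dist_nonneg)

theorem abs_m_sub_le (a b : M) : |m a - m b| ≤ dist a b := by
  rw [← dist_bot_left, ← dist_bot_left, abs_sub_le_iff]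
  constructor
  · linarith [dist_triangle ⊥ b a, dist_comm a b]
  · linarith [dist_triangle ⊥ a b]

/-- The symmetric difference of the meets lies below the join of the two symmetric differences. -/
theorem dist_inf_le (a b a' b' : M) : dist (a ⊓ b) (a' ⊓ b') ≤ dist a a' + dist b b' := by
  simp only [dist_eq_m]
  refine (m_mono ?_).trans (m_sup_le _ _)
  rw [symmDiff_le_iff]
  constructor
  · refine (inf_le_inf (le_symmDiff_sup_right a a') (le_symmDiff_sup_right b b')).trans ?_
    rw [inf_sup_left, inf_sup_right, inf_sup_right]
    refine sup_le (sup_le ?_ ?_) (sup_le ?_ le_sup_left) <;> refine le_sup_of_le_right ?_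
    · exact le_sup_of_le_left inf_le_left
    · exact le_sup_of_le_right inf_le_right
    · exact le_sup_of_le_left inf_le_left
  · refine (inf_le_inf (le_symmDiff_sup_left a a') (le_symmDiff_sup_left b b')).trans ?_
    rw [inf_sup_left, inf_sup_right, inf_sup_right]
    refine sup_le (sup_le ?_ ?_) (sup_le ?_ le_sup_left) <;> refine le_sup_of_le_right ?_
    · exact le_sup_of_le_left inf_le_left
    · exact le_sup_of_le_right inf_le_right
    · exact le_sup_of_le_left inf_le_left

theorem dist_compl (a b : M) : dist aᶜ bᶜ = dist a b := by
  rw [dist_eq_m, dist_eq_m, compl_symmDiff_compl]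

theorem lipschitzWith_m : LipschitzWith 1 (m : M → ℝ) :=
  LipschitzWith.of_dist_le_mul fun a b => by simpa [Real.dist_eq] using abs_m_sub_le a b

theorem uniformContinuous_inf : UniformContinuous fun p : M × M => p.1 ⊓ p.2 :=
  (LipschitzWith.of_dist_le_mul (K := 2) fun p q => by
    have h1 : dist p.1 q.1 ≤ dist p q := le_max_left _ _
    have h2 : dist p.2 q.2 ≤ dist p q := le_max_right _ _
    have := dist_inf_le p.1 p.2 q.1 q.2
    push_cast
    linarith).uniformContinuous

theorem uniformContinuous_compl : UniformContinuous fun a : M => aᶜ :=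
  (LipschitzWith.of_dist_le_mul (K := 1) fun a b => by simp [dist_compl]).uniformContinuous

theorem uniformContinuous_sup : UniformContinuous fun p : M × M => p.1 ⊔ p.2 := by
  have h : UniformContinuous fun p : M × M => (p.1ᶜ, p.2ᶜ) :=
    (uniformContinuous_compl.comp uniformContinuous_fst).prodMk
      (uniformContinuous_compl.comp uniformContinuous_snd)
  have := uniformContinuous_compl.comp (uniformContinuous_inf.comp h)
  refine this.congr fun p => ?_
  simp [compl_inf]

instance : ContinuousSup M := ⟨uniformContinuous_sup.continuous⟩
instance : ContinuousInf M := ⟨uniformContinuous_inf.continuous⟩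

instance : OrderClosedTopology M where
  isClosed_le' := by
    simp only [← inf_eq_left]
    exact isClosed_eq (continuous_fst.inf continuous_snd) continuous_fst

instance : CompleteSpace M := PrStructure.complete

/-- Every set has a least upper bound, which is approximated in measure by finite subsets. -/
theorem exists_isLUB (S : Set M) : ∃ s, IsLUB S s ∧
    ∀ ε : ℝ, 0 < ε → ∃ F : Finset M, (F : Set M) ⊆ S ∧ m s < m (F.sup id) + ε := by
  classical
  let D := {F : Finset M // (F : Set M) ⊆ S}
  let g : D → ℝ := fun F => m (F.1.sup id)
  have : Nonempty D := ⟨⟨∅, by simp⟩⟩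
  have hbdd : BddAbove (Set.range g) := ⟨1, by rintro _ ⟨F, rfl⟩; exact m_le_one _⟩
  let U : D → D → D := fun F G => ⟨F.1 ∪ G.1, by
    rw [Finset.coe_union]; exact Set.union_subset F.2 G.2⟩
  have hr : ∀ k : ℕ, ∃ F : D, (⨆ F, g F) - (1 / 2 : ℝ) ^ k < g F := fun k =>
    exists_lt_of_lt_ciSup (sub_lt_self _ (by positivity))
  choose F hF using hr
  -- Accumulating the sets makes the joins increase while their measures still approach the
  -- supremum. Comparable elements are at distance the difference of their measures, so the joins
  -- form a Cauchy sequence.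
  let G : ℕ → D := fun k => Nat.rec (F 0) (fun k H => U H (F (k + 1))) k
  have hGF : ∀ k, (F k).1 ⊆ (G k).1 := by
    rintro (_ | k)
    · exact subset_rfl
    · exact Finset.subset_union_right
  have hGs : ∀ k, (G k).1.sup id ≤ (G (k + 1)).1.sup id :=
    fun k => Finset.sup_mono Finset.subset_union_left
  have hGr : ∀ k, (⨆ F, g F) - (1 / 2 : ℝ) ^ k < g (G k) := fun k =>
    (hF k).trans_le (m_mono (Finset.sup_mono (hGF k)))
  have hle : ∀ H, g H ≤ ⨆ F, g F := fun H => le_ciSup hbdd H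
  have hc : CauchySeq fun k => (G k).1.sup id := by
    refine cauchySeq_of_le_geometric (1 / 2) 1 (by norm_num) fun k => ?_
    rw [dist_of_le (hGs k)]
    have := hle (G (k + 1))
    have := hGr k
    simp only [g] at *
    linarith
  obtain ⟨s, hs⟩ := cauchySeq_tendsto_of_complete hc
  have hms : Filter.Tendsto (fun k => g (G k)) Filter.atTop (nhds (m s)) :=
    (lipschitzWith_m.continuous.tendsto s).comp hs
  have hpow : Filter.Tendsto (fun k : ℕ => (1 / 2 : ℝ) ^ k) Filter.atTop (nhds 0) :=
    tendsto_pow_atTop_nhds_zero_of_lt_one (by norm_num) (by norm_num)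
  have hmr : m s = ⨆ F, g F := by
    refine le_antisymm (le_of_tendsto' hms fun k => hle _) ?_
    refine le_of_tendsto_of_tendsto' (by simpa using tendsto_const_nhds.sub hpow) hms
      fun k => (hGr k).le
  refine ⟨s, ⟨fun x hx => ?_, fun u hu => ?_⟩, fun ε hε => ?_⟩
  -- Joining `x` to the approximants gives finite joins again, so it cannot raise the limiting
  -- measure above the supremum.
  · have h1 : m (s ⊔ x) ≤ m s := by
      rw [hmr]
      have h2 : Filter.Tendsto (fun k => m ((G k).1.sup id ⊔ x)) Filter.atTop
          (nhds (m (s ⊔ x))) :=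
        (lipschitzWith_m.continuous.tendsto _).comp (hs.sup_nhds tendsto_const_nhds)
      refine le_of_tendsto' h2 fun k => ?_
      have := hle (U (G k) ⟨{x}, by simpa using hx⟩)
      simpa [g, U, Finset.sup_union, sup_comm] using this
    have := eq_of_le_of_m_le (le_sup_left : s ≤ s ⊔ x) h1
    rw [this]; exact le_sup_right
  · exact le_of_tendsto' hs fun k => Finset.sup_le fun x hx => hu ((G k).2 hx)
  · obtain ⟨H, hH⟩ := exists_lt_of_lt_ciSup (show (⨆ F, g F) - ε < ⨆ F, g F by linarith)
    exact ⟨H.1, H.2, by rw [hmr]; simp only [g] at hH ⊢; linarith⟩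

end BooleanAlgebra

end ProbAlg

namespace ProbAlg

/-! ### Maximal chains and elements of prescribed measure -/

section Chains

variable {M : Type u} [PrStructure M] [IsProbAlg M]

theorem m_compl (a : M) : m aᶜ = 1 - m a := by
  have := m_sup_of_disjoint (disjoint_compl_right (a := a))
  rw [sup_compl_eq_top, m_top] at this
  linarith

theorem exists_finset_of_isLUB {S : Set M} {s : M} (h : IsLUB S s) {ε : ℝ} (hε : 0 < ε) :
    ∃ F : Finset M, (F : Set M) ⊆ S ∧ m s < m (F.sup id) + ε := by
  obtain ⟨s', hs', h'⟩ := exists_isLUB S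
  rw [h.unique hs']
  exact h' ε hε

/-- Finite joins of members of a chain are members, with `⊥` accounting for the empty join, and they
approximate the least upper bound in measure. -/
theorem m_le_of_isLUB_of_isChain {A : Set M} (hA : IsChain (· ≤ ·) A) (hbot : ⊥ ∈ A) {s : M}
    (hs : IsLUB A s) {t : ℝ} (ht : ∀ x ∈ A, m x ≤ t) : m s ≤ t := by
  refine le_of_forall_pos_le_add fun ε hε => ?_
  obtain ⟨F, hF, h⟩ := exists_finset_of_isLUB hs hε
  have : F.sup id ∈ A := Finset.sup_mem A hbot (fun x hx y hy => by
    rcases hA.total hx hy with h | h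
    · rwa [sup_eq_right.2 h]
    · rwa [sup_eq_left.2 h]) _ _ fun i hi => hF hi
  linarith [ht _ this]

theorem exists_isGLB_of_isChain {B : Set M} (hB : IsChain (· ≤ ·) B) (htop : ⊤ ∈ B) {t : ℝ}
    (ht : ∀ x ∈ B, t ≤ m x) : ∃ s, IsGLB B s ∧ t ≤ m s := by
  obtain ⟨s, hs, -⟩ := exists_isLUB (compl '' B)
  have h1 : m s ≤ 1 - t := by
    refine m_le_of_isLUB_of_isChain (A := compl '' B) ?_ ⟨⊤, htop, compl_top⟩ hs ?_
    · rintro _ ⟨x, hx, rfl⟩ _ ⟨y, hy, rfl⟩ -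
      simpa using (hB.total hx hy).symm
    · rintro _ ⟨x, hx, rfl⟩
      rw [m_compl]; linarith [ht x hx]
  refine ⟨sᶜ, ⟨fun x hx => compl_le_of_compl_le (hs.1 ⟨x, hx, rfl⟩), fun u hu => ?_⟩, by
    rw [m_compl]; linarith⟩
  refine le_compl_of_le_compl (hs.2 ?_)
  rintro _ ⟨x, hx, rfl⟩
  exact compl_le_compl (hu hx)

/-- There is a chain below `p` whose measures leave gaps only at atoms. -/
theorem exists_chain (p : M) : ∃ C : Set M, IsChain (· ≤ ·) C ∧ ∀ t, 0 ≤ t → t ≤ m p →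
    ∃ c ∈ C, ∃ c' ∈ C, c ≤ c' ∧ c' ≤ p ∧ m c ≤ t ∧ t ≤ m c' ∧ ∀ z, z < c' \ c → z = ⊥ := by
  -- By maximality, an element comparable with all of `C` belongs to `C`. Below, `C` is cut at
  -- measure `t`: `c` is the join of the lower part and `c'` the meet of the upper part. Anything
  -- between them is in `C`, hence in one of the two parts, so it is `c` or `c'`.
  obtain ⟨C, hC, hpC⟩ := (IsChain.singleton (r := (· ≤ ·)) (a := p)).exists_maxChain
  have hp : p ∈ C := hpC rfl
  have hmem : ∀ x, (∀ y ∈ C, x ≤ y ∨ y ≤ x) → x ∈ C := fun x hx => by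
    rw [hC.2 (hC.1.insert fun y hy _ => hx y hy) (Set.subset_insert x C)]
    exact Set.mem_insert _ _
  refine ⟨C, hC.1, fun t h0 htp => ?_⟩
  have hbot : (⊥ : M) ∈ C := hmem _ fun y _ => Or.inl bot_le
  have htop : (⊤ : M) ∈ C := hmem _ fun y _ => Or.inr le_top
  let A : Set M := {c ∈ C | m c ≤ t}
  let B : Set M := {c ∈ C | t ≤ m c}
  have hA : IsChain (· ≤ ·) A := hC.1.mono fun x hx => hx.1
  have hB : IsChain (· ≤ ·) B := hC.1.mono fun x hx => hx.1
  have hAB : ∀ x ∈ A, ∀ y ∈ B, x ≤ y := fun x hx y hy => by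
    rcases hC.1.total hx.1 hy.1 with h | h
    · exact h
    · exact (eq_of_le_of_m_le h (hx.2.trans hy.2)).ge
  have hbotA : (⊥ : M) ∈ A := ⟨hbot, by rwa [m_bot]⟩
  have htopB : (⊤ : M) ∈ B := ⟨htop, htp.trans (m_mono le_top)⟩
  obtain ⟨c, hc, -⟩ := exists_isLUB A
  obtain ⟨c', hc', htc'⟩ := exists_isGLB_of_isChain hB htopB fun x hx => hx.2
  have hct : m c ≤ t := m_le_of_isLUB_of_isChain hA hbotA hc fun x hx => hx.2
  have hcc' : c ≤ c' := hc'.2 fun y hy => hc.2 fun x hx => hAB x hx y hy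
  have hbetween : ∀ w, c ≤ w → w ≤ c' → w ∈ C := fun w h1 h2 => hmem w fun y hy => by
    rcases le_total (m y) t with h | h
    · exact Or.inr ((hc.1 ⟨hy, h⟩).trans h1)
    · exact Or.inl (h2.trans (hc'.1 ⟨hy, h⟩))
  refine ⟨c, hbetween c le_rfl hcc', c', hbetween c' hcc' le_rfl, hcc', hc'.1 ⟨hp, htp⟩, hct,
    htc', fun z hz => ?_⟩
  have hzc : Disjoint z c := disjoint_sdiff_self_left.mono_left hz.le
  have hw : c ⊔ z ∈ C := hbetween _ le_sup_left (sup_le hcc' (hz.le.trans sdiff_le))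
  rcases le_total (m (c ⊔ z)) t with h | h
  · exact hzc.eq_bot_of_le (le_sup_right.trans (hc.1 ⟨hw, h⟩))
  · have : c' \ c ≤ z := sdiff_le_iff.2 (hc'.1 ⟨hw, h⟩)
    exact absurd hz this.not_gt

/-- Below an element without atoms there is a continuous path of elements of given measure. -/
theorem exists_path {p : M} (hp : ∀ e, IsAtom e → ¬ e ≤ p) : ∃ γ : ℝ → M, Continuous γ ∧
    ∀ t ∈ Set.Icc 0 (m p), γ t ≤ p ∧ m (γ t) = t := by
  obtain ⟨C, hC, h⟩ := exists_chain p
  have h1 : ∀ t : Set.Icc 0 (m p), ∃ c ∈ C, c ≤ p ∧ m c = t := fun t => by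
    obtain ⟨c, hc, c', hc', hcc', hp', h1, h2, h3⟩ := h t t.2.1 t.2.2
    have : c' \ c = ⊥ := by
      by_contra hne
      exact hp _ ⟨hne, h3⟩ (sdiff_le.trans hp')
    have := le_antisymm hcc' (sdiff_eq_bot_iff.1 this)
    subst this
    exact ⟨c, hc, hp', le_antisymm h1 h2⟩
  choose γ hγC hγp hγm using h1
  -- The values of `γ` lie in a chain, where distance is the difference of measures.
  have hiso : Isometry γ := Isometry.of_dist_eq fun s t => by
    rw [Subtype.dist_eq, Real.dist_eq, ← hγm s, ← hγm t]
    rcases hC.total (hγC s) (hγC t) with h | h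
    · rw [dist_of_le h, abs_sub_comm, abs_of_nonneg (sub_nonneg.2 (m_mono h))]
    · rw [dist_comm, dist_of_le h, abs_of_nonneg (sub_nonneg.2 (m_mono h))]
  refine ⟨Set.IccExtend (m_nonneg p) γ, hiso.continuous.Icc_extend', fun t ht => ?_⟩
  rw [Set.IccExtend_of_mem _ _ ht]
  exact ⟨hγp _, hγm _⟩

end Chains

/-! ### Atoms and the atomless part -/

section Atoms

variable {M : Type u} [PrStructure M] [IsProbAlg M]

theorem le_or_disjoint_of_isAtom {e : M} (he : IsAtom e) (a : M) : e ≤ a ∨ Disjoint e a := by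
  by_cases h : e ⊓ a = ⊥
  · exact Or.inr (disjoint_iff.2 h)
  · exact Or.inl (inf_eq_left.1 ((he.le_iff.1 inf_le_left).resolve_left h))

theorem disjoint_isLUB {S : Set M} {s x : M} (hs : IsLUB S s) (h : ∀ e ∈ S, Disjoint e x) :
    Disjoint s x :=
  le_compl_iff_disjoint_right.1 (hs.2 fun e he => le_compl_iff_disjoint_right.2 (h e he))

/-- The atoms below `p`. -/
def atoms (p : M) : Set M := {e | IsAtom e ∧ e ≤ p}

theorem atoms_mono {p q : M} (h : p ≤ q) : atoms p ⊆ atoms q := fun _ he => ⟨he.1, he.2.trans h⟩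

theorem disjoint_of_isAtom {e f : M} (he : IsAtom e) (hf : IsAtom f) (hne : e ≠ f) :
    Disjoint e f :=
  (le_or_disjoint_of_isAtom he f).resolve_left fun h =>
    hne ((hf.le_iff.1 h).resolve_left he.1)

theorem mem_of_le_isLUB {S : Set M} (hS : S ⊆ atoms ⊤) {s e : M} (hs : IsLUB S s)
    (he : IsAtom e) (hes : e ≤ s) : e ∈ S := by
  by_contra h
  have : Disjoint s e := disjoint_isLUB hs fun f hf =>
    disjoint_of_isAtom (hS hf).1 he fun hfe => h (hfe ▸ hf)
  exact he.1 (this.symm.eq_bot_of_le hes)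

/-- The largest element without atoms. -/
noncomputable def cont (M : Type u) [PrStructure M] [IsProbAlg M] : M :=
  (exists_isLUB (atoms (⊤ : M))).chooseᶜ

theorem isLUB_atoms_top : IsLUB (atoms (⊤ : M)) (cont M)ᶜ := by
  rw [cont, compl_compl]
  exact (exists_isLUB (atoms (⊤ : M))).choose_spec.1

theorem disjoint_cont_of_isAtom {e : M} (he : IsAtom e) : Disjoint e (cont M) :=
  le_compl_iff_disjoint_right.1 (isLUB_atoms_top.1 ⟨he, le_top⟩)

theorem not_le_cont {e : M} (he : IsAtom e) : ¬ e ≤ cont M := fun h =>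
  he.1 ((disjoint_cont_of_isAtom he).eq_bot_of_le h)

/-- For an upper bound `u` of the atoms below `p`, the element `p ⊓ uᶜ` is disjoint from every atom
and therefore lies below `cont M`. -/
theorem isLUB_atoms (p : M) : IsLUB (atoms p) (p \ cont M) := by
  refine ⟨fun e he => le_sdiff.2 ⟨he.2, disjoint_cont_of_isAtom he.1⟩, fun u hu => ?_⟩
  have h : Disjoint (cont M)ᶜ (p ⊓ uᶜ) := disjoint_isLUB isLUB_atoms_top fun e he => by
    rcases le_or_disjoint_of_isAtom he.1 p with h | h
    · exact (disjoint_compl_right.mono_left (hu ⟨he.1, h⟩)).mono_right inf_le_right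
    · exact h.mono_right inf_le_left
  rw [sdiff_eq, ← disjoint_compl_right_iff, disjoint_iff, inf_right_comm, inf_comm]
  exact h.eq_bot

theorem sum_m_eq {F : Finset M} (hF : (F : Set M) ⊆ atoms ⊤) : ∑ e ∈ F, m e = m (F.sup id) := by
  classical
  induction F using Finset.induction_on with
  | empty => simp
  | insert a F ha ih =>
    rw [Finset.coe_insert, Set.insert_subset_iff] at hF
    rw [Finset.sum_insert ha, ih hF.2, Finset.sup_insert, m_sup_of_disjoint, id]
    exact Finset.disjoint_sup_right.2 fun b hb =>
      disjoint_of_isAtom hF.1.1 (hF.2 hb).1 fun h => ha ((show a = b from h) ▸ hb)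

/-- Distinct atoms are disjoint, so finite sums are measures of finite joins, and these approximate
the full join. -/
theorem hasSum_m {S : Set M} (hS : S ⊆ atoms ⊤) {s : M} (hs : IsLUB S s) :
    HasSum (fun e : S => m (e : M)) (m s) := by
  classical
  refine hasSum_of_isLUB_of_nonneg _ (fun _ => m_nonneg _) ⟨?_, fun u hu => ?_⟩
  · rintro _ ⟨G, rfl⟩
    have h1 : ((G.map (Function.Embedding.subtype _) : Finset M) : Set M) ⊆ S := by
      intro x; simp +contextual
    have h2 := sum_m_eq (h1.trans hS)
    rw [Finset.sum_map] at h2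
    refine h2.le.trans (m_mono (Finset.sup_le fun x hx => hs.1 (h1 hx)))
  · refine le_of_forall_pos_le_add fun ε hε => ?_
    obtain ⟨F, hF, h⟩ := exists_finset_of_isLUB hs hε
    have := hu ⟨F.subtype (· ∈ S), rfl⟩
    rw [← sum_m_eq (hF.trans hS)] at h
    simp only at this
    rw [Finset.sum_subtype_of_mem m (fun x hx => hF hx)] at this
    linarith

theorem hasSum_atoms (p : M) : HasSum (fun e : atoms p => m (e : M)) (m (p \ cont M)) :=
  hasSum_m (atoms_mono le_top) (isLUB_atoms p)

theorem countable_atoms : (atoms (⊤ : M)).Countable := by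
  have := (hasSum_atoms (⊤ : M)).summable.countable_support
  rw [Function.support_eq_univ fun e : atoms (⊤ : M) => (m_pos e.2.1.1).ne'] at this
  exact Set.countable_coe_iff.1 (Set.countable_univ_iff.1 this)

end Atoms

end ProbAlg

/-! ### Profiles and their splitting -/

namespace ProbAlg

section Profile

variable {M : Type u} {N : Type v} [PrStructure M] [IsProbAlg M] [PrStructure N] [IsProbAlg N]

/-- `p` and `q` have the same measure, and the same measures of atoms below them. -/
def SameProfile (p : M) (q : N) : Prop :=
  m p = m q ∧ ∃ f : M → N, Set.BijOn f (atoms p) (atoms q) ∧ ∀ e ∈ atoms p, m (f e) = m e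

theorem SameProfile.symm {p : M} {q : N} (h : SameProfile p q) : SameProfile q p := by
  obtain ⟨hm, f, hf, hfm⟩ := h
  have : Nonempty M := ⟨⊥⟩
  have hinv := hf.invOn_invFunOn
  refine ⟨hm.symm, Function.invFunOn f (atoms p), hf.symm hinv.symm, fun e he => ?_⟩
  rw [← hfm _ ((hf.symm hinv.symm).mapsTo he), hinv.2 he]

theorem SameProfile.of_atoms_eq {p q : M} (h : m p = m q) (h' : atoms p = atoms q) :
    SameProfile p q := ⟨h, id, h' ▸ Set.bijOn_id _, fun _ _ => rfl⟩

theorem m_eq_of_bijOn {S : Set M} {S' : Set N} {f : M → N} (hf : Set.BijOn f S S')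
    (hm : ∀ e ∈ S, m (f e) = m e) (hS : S ⊆ atoms ⊤) (hS' : S' ⊆ atoms ⊤) {s : M} {s' : N}
    (hs : IsLUB S s) (hs' : IsLUB S' s') : m s = m s' := by
  have h2 := (Equiv.hasSum_iff (Set.BijOn.equiv f hf)).2 (hasSum_m hS' hs')
  refine (hasSum_m hS hs).unique (h2.congr_fun ?_)
  exact fun e => (hm e e.2).symm

/-- The total measures agree and so do the measures of the atomic parts; subtract. -/
theorem SameProfile.m_inf_cont {p : M} {q : N} (h : SameProfile p q) :
    m (p ⊓ cont M) = m (q ⊓ cont N) := by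
  obtain ⟨hm, f, hf, hfm⟩ := h
  have := m_eq_of_bijOn hf hfm (atoms_mono le_top) (atoms_mono le_top) (isLUB_atoms p)
    (isLUB_atoms q)
  linarith [m_inf_add_m_sdiff p (cont M), m_inf_add_m_sdiff q (cont N)]

/-- The back-and-forth step inside one cell. The witness joins the images of the atoms below `c` to
a piece `z` of the atomless part of `q` with the measure of the atomless part of `c`. The same
bijection `f` then serves for both halves. -/
theorem SameProfile.split {p : M} {q : N} (h : SameProfile p q) {c : M} (hc : c ≤ p) :
    ∃ d ≤ q, SameProfile c d ∧ SameProfile (p \ c) (q \ d) := by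
  have hcont := h.m_inf_cont
  obtain ⟨hm, f, hf, hfm⟩ := h
  obtain ⟨γ, -, hγ⟩ := exists_path (p := q ⊓ cont N)
    fun e he h => not_le_cont he (h.trans inf_le_right)
  obtain ⟨hzq, hzm⟩ := hγ (m (c ⊓ cont M)) ⟨m_nonneg _, hcont ▸ m_mono (inf_le_inf_right _ hc)⟩
  set z := γ (m (c ⊓ cont M))
  have hS : f '' atoms c ⊆ atoms q := (hf.mapsTo.mono_left (atoms_mono hc)).image_subset
  obtain ⟨s, hs, -⟩ := exists_isLUB (f '' atoms c)
  have hsz : Disjoint s z := disjoint_isLUB hs fun e he =>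
    (disjoint_cont_of_isAtom (hS he).1).mono_right (hzq.trans inf_le_right)
  have hd : s ⊔ z ≤ q := sup_le (hs.2 fun e he => (hS he).2) (hzq.trans inf_le_left)
  -- No atom lies below the atomless `z`, and an atom below the join `s` of atoms is one of them; so
  -- `f` neither loses nor gains atoms.
  have hmem : ∀ e ∈ atoms p, (f e ≤ s ⊔ z ↔ e ≤ c) := fun e he => by
    have hfe := hf.mapsTo he
    constructor
    · intro h
      rcases le_or_disjoint_of_isAtom hfe.1 s with h1 | h1
      · obtain ⟨e', he', h2⟩ := mem_of_le_isLUB (hS.trans (atoms_mono le_top)) hs hfe.1 h1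
        exact hf.injOn (atoms_mono hc he') he h2 ▸ he'.2
      · exact absurd ((h1.left_le_of_le_sup_left h).trans (hzq.trans inf_le_right))
          (not_le_cont hfe.1)
    · exact fun h => (hs.1 ⟨e, ⟨he.1, h⟩, rfl⟩).trans le_sup_left
  have hmd : m c = m (s ⊔ z) := by
    have h1 := m_eq_of_bijOn ((hf.injOn.mono (atoms_mono hc)).bijOn_image)
      (fun e he => hfm e (atoms_mono hc he)) (atoms_mono le_top) (hS.trans (atoms_mono le_top))
      (isLUB_atoms c) hs
    rw [m_sup_of_disjoint hsz, hzm, ← m_inf_add_m_sdiff c (cont M), h1, add_comm]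
  refine ⟨s ⊔ z, hd, ⟨hmd, f, ⟨fun e he => ?_, hf.injOn.mono (atoms_mono hc), fun e' he' => ?_⟩,
    fun e he => hfm e (atoms_mono hc he)⟩, ?_, f, ⟨fun e he => ?_,
    hf.injOn.mono (atoms_mono sdiff_le), fun e' he' => ?_⟩,
    fun e he => hfm e (atoms_mono sdiff_le he)⟩
  · exact ⟨(hf.mapsTo (atoms_mono hc he)).1, (hmem e (atoms_mono hc he)).2 he.2⟩
  · obtain ⟨e, he, rfl⟩ := hf.surjOn (atoms_mono hd he')
    exact ⟨e, ⟨he.1, (hmem e he).1 he'.2⟩, rfl⟩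
  · rw [m_sdiff_of_le hc, m_sdiff_of_le hd, hm, hmd]
  · have hep := atoms_mono sdiff_le he
    have hfe := hf.mapsTo hep
    refine ⟨hfe.1, le_sdiff.2 ⟨hfe.2, (le_or_disjoint_of_isAtom hfe.1 _).resolve_left ?_⟩⟩
    intro h
    exact he.1.1 ((le_sdiff.1 he.2).2.eq_bot_of_le ((hmem e hep).1 h))
  · obtain ⟨e, he, rfl⟩ := hf.surjOn (atoms_mono sdiff_le he')
    refine ⟨e, ⟨he.1, le_sdiff.2 ⟨he.2, (le_or_disjoint_of_isAtom he.1 _).resolve_left ?_⟩⟩, rfl⟩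
    intro h
    exact he'.1.1 ((le_sdiff.1 he'.2).2.eq_bot_of_le ((hmem e he).2 h))

end Profile

/-! ### Cells of a finite tuple -/

section Cells

variable {M : Type u} [PrStructure M] [IsProbAlg M]

/-- The atoms of the Boolean algebra generated by a tuple (some of them may be `⊥`). -/
noncomputable def cell : {n : ℕ} → (Fin n → M) → (Fin n → Bool) → M
  | 0, _, _ => ⊤
  | n + 1, a, ρ => cell (Fin.init a) (Fin.init ρ) ⊓
      bif ρ (Fin.last n) then a (Fin.last n) else (a (Fin.last n))ᶜ

theorem cell_snoc {n : ℕ} (a : Fin n → M) (c : M) (ρ : Fin (n + 1) → Bool) :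
    cell (Fin.snoc a c : Fin (n + 1) → M) ρ =
      cell a (Fin.init ρ) ⊓ bif ρ (Fin.last n) then c else cᶜ := by
  rw [cell, Fin.init_snoc, Fin.snoc_last]

theorem cell_le {n : ℕ} (a : Fin n → M) (ρ : Fin n → Bool) (i : Fin n) :
    cell a ρ ≤ bif ρ i then a i else (a i)ᶜ := by
  induction n with
  | zero => exact i.elim0
  | succ n ih =>
    rw [cell]
    induction i using Fin.lastCases with
    | last => exact inf_le_right
    | cast i => exact inf_le_left.trans (ih (Fin.init a) (Fin.init ρ) i)

theorem disjoint_cell {n : ℕ} (a : Fin n → M) {ρ τ : Fin n → Bool} (h : ρ ≠ τ) :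
    Disjoint (cell a ρ) (cell a τ) := by
  obtain ⟨i, hi⟩ := Function.ne_iff.1 h
  refine Disjoint.mono (cell_le a ρ i) (cell_le a τ i) ?_
  cases h1 : ρ i <;> cases h2 : τ i
  · simp_all
  · exact disjoint_compl_left
  · exact disjoint_compl_right
  · simp_all

theorem eq_bot_of_inf_cell {n : ℕ} (a : Fin n → M) {x : M} (h : ∀ ρ, x ⊓ cell a ρ = ⊥) :
    x = ⊥ := by
  induction n with
  | zero => simpa [cell] using h Fin.elim0
  | succ n ih =>
    refine ih (Fin.init a) fun ρ => ?_
    have h1 := h (Fin.snoc ρ true)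
    have h2 := h (Fin.snoc ρ false)
    rw [cell, Fin.init_snoc, Fin.snoc_last, ← inf_assoc] at h1 h2
    exact (disjoint_iff.2 h1).eq_bot_of_le (disjoint_compl_right_iff.1 (disjoint_iff.2 h2))

theorem le_of_inf_cell_le {n : ℕ} (a : Fin n → M) {x y : M} (h : ∀ ρ, x ⊓ cell a ρ ≤ y) :
    x ≤ y := by
  rw [← sdiff_eq_bot_iff]
  refine eq_bot_of_inf_cell a fun ρ => ?_
  rw [sdiff_eq, inf_right_comm, ← sdiff_eq, sdiff_eq_bot_iff]
  exact h ρ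

/-- Since cells are disjoint, choices made separately in each cell glue to one element from which
every choice can be recovered. -/
theorem cell_inf_sup {n : ℕ} (b : Fin n → M) {d : (Fin n → Bool) → M}
    (hd : ∀ ρ, d ρ ≤ cell b ρ) (ρ : Fin n → Bool) :
    cell b ρ ⊓ Finset.univ.sup d = d ρ := by
  refine le_antisymm ?_ (le_inf (hd ρ) (Finset.le_sup (Finset.mem_univ ρ)))
  rw [Finset.sup_inf_distrib_left]
  refine Finset.sup_le fun τ _ => ?_
  by_cases h : ρ = τ
  · subst h; exact inf_le_right
  · rw [((disjoint_cell b h).mono_right (hd τ)).eq_bot]; exact bot_le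

theorem sum_m_eq_m_sup {ι : Type*} (F : Finset ι) (f : ι → M)
    (h : ∀ i ∈ F, ∀ j ∈ F, i ≠ j → Disjoint (f i) (f j)) : m (F.sup f) = ∑ i ∈ F, m (f i) := by
  classical
  induction F using Finset.induction_on with
  | empty => simp
  | insert i F hi ih =>
    rw [Finset.sum_insert hi, Finset.sup_insert, m_sup_of_disjoint, ih]
    · exact fun j hj k hk => h j (Finset.mem_insert_of_mem hj) k (Finset.mem_insert_of_mem hk)
    · exact Finset.disjoint_sup_right.2 fun j hj => h i (Finset.mem_insert_self _ _) j
        (Finset.mem_insert_of_mem hj) fun h => hi (h ▸ hj)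

/-- The value of a term in the two-element algebra. -/
def bval {n : ℕ} : PrTerm n → (Fin n → Bool) → Bool
  | .var i, ρ => ρ i
  | .zero, _ => false
  | .one, _ => true
  | .compl t, ρ => !(bval t ρ)
  | .inter t s, ρ => bval t ρ && bval s ρ
  | .union t s, ρ => bval t ρ || bval s ρ

theorem cell_le_eval {n : ℕ} (a : Fin n → M) (ρ : Fin n → Bool) (t : PrTerm n) :
    (bval t ρ = true → cell a ρ ≤ t.eval a) ∧
      (bval t ρ = false → Disjoint (cell a ρ) (t.eval a)) := by
  induction t with
  | var i =>
    have := cell_le a ρ i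
    refine ⟨fun h => ?_, fun h => ?_⟩ <;> rw [bval] at h <;> rw [h] at this
    · exact this
    · exact le_compl_iff_disjoint_right.1 this
  | zero => exact ⟨fun h => by simp [bval] at h, fun _ => disjoint_bot_right⟩
  | one => exact ⟨fun _ => le_top (α := M), fun h => by simp [bval] at h⟩
  | compl t ih =>
    simp only [bval, Bool.not_eq_true', Bool.not_eq_false']
    exact ⟨fun h => le_compl_iff_disjoint_right.2 (ih.2 h),
      fun h => disjoint_compl_right_iff.2 (ih.1 h)⟩
  | inter t s iht ihs =>
    simp only [bval, Bool.and_eq_true, Bool.and_eq_false_iff]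
    refine ⟨fun h => le_inf (iht.1 h.1) (ihs.1 h.2), ?_⟩
    rintro (h | h)
    · exact (iht.2 h).mono_right inf_le_left
    · exact (ihs.2 h).mono_right inf_le_right
  | union t s iht ihs =>
    simp only [bval, Bool.or_eq_true, Bool.or_eq_false_iff]
    refine ⟨?_, fun h => disjoint_sup_right.2 ⟨iht.2 h.1, ihs.2 h.2⟩⟩
    rintro (h | h)
    · exact (iht.1 h).trans le_sup_left
    · exact (ihs.1 h).trans le_sup_right

/-- A term is the join of the cells on which it is true, so the measures of the cells determine all
atomic formulas. -/
theorem m_eval {n : ℕ} (a : Fin n → M) (t : PrTerm n) :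
    m (t.eval a) = ∑ ρ with bval t ρ = true, m (cell a ρ) := by
  rw [← sum_m_eq_m_sup _ _ fun i _ j _ h => disjoint_cell a h]
  congr 1
  refine le_antisymm (le_of_inf_cell_le a fun ρ => ?_)
    (Finset.sup_le fun ρ hρ => (cell_le_eval a ρ t).1 (Finset.mem_filter.1 hρ).2)
  cases h : bval t ρ
  · rw [inf_comm, ((cell_le_eval a ρ t).2 h).eq_bot]; exact bot_le
  · exact inf_le_right.trans (Finset.le_sup (f := cell a) (by simpa using h))

end Cells

/-! ### The back-and-forth system -/

section Rel

variable {M : Type u} {N : Type v} [PrStructure M] [IsProbAlg M] [PrStructure N] [IsProbAlg N]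

/-- Corresponding cells of the tuples have the same profile. -/
def Rel {n : ℕ} (a : Fin n → M) (b : Fin n → N) : Prop :=
  ∀ ρ, SameProfile (cell a ρ) (cell b ρ)

theorem Rel.symm {n : ℕ} {a : Fin n → M} {b : Fin n → N} (h : Rel a b) : Rel b a :=
  fun ρ => (h ρ).symm

/-- Adding `c` splits each cell into its parts inside and outside `c`; `SameProfile.split` copies
every splitting, and the copies are glued. -/
theorem Rel.extend {n : ℕ} {a : Fin n → M} {b : Fin n → N} (h : Rel a b) (c : M) :
    ∃ d : N, Rel (Fin.snoc a c : Fin (n + 1) → M) (Fin.snoc b d : Fin (n + 1) → N) := by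
  choose d hd h1 h2 using fun ρ => (h ρ).split (inf_le_left : cell a ρ ⊓ c ≤ cell a ρ)
  refine ⟨Finset.univ.sup d, fun ρ => ?_⟩
  have hinf := cell_inf_sup b hd (Fin.init ρ)
  rw [cell_snoc, cell_snoc]
  cases ρ (Fin.last n)
  · have := h2 (Fin.init ρ)
    rw [← hinf, sdiff_inf_self_left, sdiff_inf_self_left] at this
    simpa [sdiff_eq] using this
  · have := h1 (Fin.init ρ)
    rw [← hinf] at this
    exact this

theorem Rel.m_eval_eq {n : ℕ} {a : Fin n → M} {b : Fin n → N} (h : Rel a b) (t : PrTerm n) :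
    m (t.eval a) = m (t.eval b) := by
  rw [m_eval, m_eval]
  exact Finset.sum_congr rfl fun ρ _ => (h ρ).1

theorem dist_eval {n : ℕ} (a : Fin n → M) (t s : PrTerm n) :
    dist (t.eval a) (s.eval a) = m ((t.symmDiff s).eval a) := IsProbAlg.dist_eq _ _

theorem Rel.dist_eval_eq {n : ℕ} {a : Fin n → M} {b : Fin n → N} (h : Rel a b)
    (t s : PrTerm n) : dist (t.eval a) (s.eval a) = dist (t.eval b) (s.eval b) := by
  rw [dist_eval, dist_eval, h.m_eval_eq]

/-- Related tuples satisfy the same formulas. -/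
theorem Rel.eval_eq {n : ℕ} {a : Fin n → M} {b : Fin n → N} (h : Rel a b) (φ : PrFormula n) :
    φ.eval a = φ.eval b := by
  induction φ with
  | mu t => exact mu_eq_mu_iff.2 (h.m_eval_eq t)
  | d t s => exact Subtype.ext (h.dist_eval_eq t s)
  | conn f φ ih => exact congrArg f (funext fun i => ih i h)
  | sup φ ih =>
    -- Each value occurring on one side also occurs on the other, at a related witness.
    refine le_antisymm (iSup_le fun c => ?_) (iSup_le fun d => ?_)
    · obtain ⟨d, hd⟩ := h.extend c
      rw [ih hd]
      exact le_iSup (fun d : N => φ.eval (Fin.snoc b d)) d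
    · obtain ⟨c, hc⟩ := h.symm.extend d
      rw [← ih hc.symm]
      exact le_iSup (fun c : M => φ.eval (Fin.snoc a c)) c
  | inf φ ih =>
    refine le_antisymm (le_iInf fun d => ?_) (le_iInf fun c => ?_)
    · obtain ⟨c, hc⟩ := h.symm.extend d
      rw [← ih hc.symm]
      exact iInf_le (fun c : M => φ.eval (Fin.snoc a c)) c
    · obtain ⟨d, hd⟩ := h.extend c
      rw [ih hd]
      exact iInf_le (fun d : N => φ.eval (Fin.snoc b d)) d

end Rel

end ProbAlg

/-! ### Formulas that measure atoms -/

/-- A term, viewed as a term in one more variable. -/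
def PrTerm.lift {n : ℕ} : PrTerm n → PrTerm (n + 1)
  | .var i => .var i.castSucc
  | .zero => .zero
  | .one => .one
  | .compl t => .compl t.lift
  | .inter t s => .inter t.lift s.lift
  | .union t s => .union t.lift s.lift

theorem PrTerm.eval_lift {M : Type u} [PrStructure M] {n : ℕ} (t : PrTerm n) (a : Fin n → M)
    (c : M) : t.lift.eval (Fin.snoc a c : Fin (n + 1) → M) = t.eval a := by
  induction t with
  | var i => exact Fin.snoc_castSucc (α := fun _ => M) c a i
  | zero => rfl
  | one => rfl
  | compl t ih => simp only [PrTerm.lift, PrTerm.eval, ih]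
  | inter t s iht ihs => simp only [PrTerm.lift, PrTerm.eval, iht, ihs]
  | union t s iht ihs => simp only [PrTerm.lift, PrTerm.eval, iht, ihs]

theorem PrTerm.eval_var_last {M : Type u} [PrStructure M] {n : ℕ} (a : Fin n → M) (c : M) :
    (PrTerm.var (Fin.last n)).eval (Fin.snoc a c : Fin (n + 1) → M) = c :=
  Fin.snoc_last (α := fun _ => M) c a

/-- The minimum of two numbers as a connective. -/
def connMin : C(Fin 2 → I, I) where
  toFun x := min (x 0) (x 1)
  continuous_toFun := by fun_prop

namespace ProbAlg

section Spectrum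

variable {M : Type u} [PrStructure M] [IsProbAlg M]

/-- The difference between the measures of the two parts into which `y` splits `x`. -/
noncomputable def gap (x y : M) : I := connAbs ![PrStructure.mu (x ⊓ y), PrStructure.mu (x ⊓ yᶜ)]

theorem coe_gap (x y : M) : (gap x y : ℝ) = |m (x ⊓ y) - m (x ⊓ yᶜ)| := rfl

/-- How evenly `x` can be split. -/
noncomputable def minGap (x : M) : I := ⨅ y, gap x y

/-- The measure of the `k`-th largest atom below `p`. -/
noncomputable def level : ℕ → M → I
  | 0, _ => 1
  | k + 1, p => ⨆ x, min (minGap (p ⊓ x)) (level k (p ⊓ xᶜ))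

/-- The formula defining `minGap`. -/
noncomputable def minGapFormula {n : ℕ} (t : PrTerm n) : PrFormula n :=
  .inf (.absDiff (.mu (.inter t.lift (.var (Fin.last n))))
    (.mu (.inter t.lift (.compl (.var (Fin.last n))))))

/-- The formula defining `level`. -/
noncomputable def levelFormula : ℕ → {n : ℕ} → PrTerm n → PrFormula n
  | 0, _, _ => .oneConst
  | k + 1, n, t => .sup (.conn connMin
    ![minGapFormula (.inter t.lift (.var (Fin.last n))),
      levelFormula k (.inter t.lift (.compl (.var (Fin.last n))))])

theorem eval_inter_lift {n : ℕ} (t : PrTerm n) (a : Fin n → M) (c : M) :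
    (PrTerm.inter t.lift (.var (Fin.last n))).eval (Fin.snoc a c : Fin (n + 1) → M) =
      t.eval a ⊓ c := by
  rw [PrTerm.eval, PrTerm.eval_lift, PrTerm.eval_var_last]; rfl

theorem eval_inter_lift_compl {n : ℕ} (t : PrTerm n) (a : Fin n → M) (c : M) :
    (PrTerm.inter t.lift (.compl (.var (Fin.last n)))).eval (Fin.snoc a c : Fin (n + 1) → M) =
      t.eval a ⊓ cᶜ := by
  rw [PrTerm.eval, PrTerm.eval_lift, PrTerm.eval, PrTerm.eval_var_last]; rfl

theorem eval_minGapFormula {n : ℕ} (t : PrTerm n) (a : Fin n → M) :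
    (minGapFormula t).eval a = minGap (t.eval a) := by
  refine iInf_congr fun c => ?_
  rw [gap, ← eval_inter_lift, ← eval_inter_lift_compl]
  refine congrArg connAbs (funext fun i => ?_)
  fin_cases i <;> rfl

theorem eval_levelFormula (k : ℕ) {n : ℕ} (t : PrTerm n) (a : Fin n → M) :
    (levelFormula k t).eval a = level k (t.eval a) := by
  induction k generalizing n with
  | zero => rfl
  | succ k ih =>
    refine iSup_congr fun c => ?_
    rw [← eval_inter_lift, ← eval_inter_lift_compl, ← ih, ← eval_minGapFormula]
    rfl

/-- A maximal chain must jump across `m x / 2`. Both ends of the jump miss the half by more than `s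
/ 2`, so the jump, which can only be an atom, has measure above `s`. -/
theorem exists_atom_of_lt_minGap {x : M} {s : I} (h : s < minGap x) :
    ∃ e ∈ atoms x, (s : ℝ) < m e := by
  have hgap : ∀ c ≤ x, (s : ℝ) < |2 * m c - m x| := fun c hc => by
    have h1 : (s : ℝ) < gap x c := h.trans_le (iInf_le _ c)
    rw [coe_gap, inf_eq_right.2 hc, ← sdiff_eq, m_sdiff_of_le hc] at h1
    rwa [show 2 * m c - m x = m c - (m x - m c) by ring]
  have hs : (0 : ℝ) ≤ s := s.2.1
  have hx := m_nonneg x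
  obtain ⟨C, -, hC⟩ := exists_chain x
  obtain ⟨c, -, c', -, hcc', hc'x, h1, h2, h3⟩ := hC (m x / 2) (by linarith) (by linarith)
  have g1 := hgap c (hcc'.trans hc'x)
  have g2 := hgap c' hc'x
  rw [abs_of_nonpos (by linarith)] at g1
  rw [abs_of_nonneg (by linarith)] at g2
  have hm : (s : ℝ) < m (c' \ c) := by rw [m_sdiff_of_le hcc']; linarith
  refine ⟨c' \ c, ⟨⟨fun h0 => ?_, h3⟩, sdiff_le.trans hc'x⟩, hm⟩
  rw [h0, m_bot] at hm
  linarith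

theorem le_minGap_of_isAtom {e : M} (he : IsAtom e) : PrStructure.mu e ≤ minGap e := by
  refine le_iInf fun y => ?_
  rw [← Subtype.coe_le_coe, coe_gap, coe_mu]
  rcases le_or_disjoint_of_isAtom he y with h | h
  · rw [inf_eq_left.2 h, ← sdiff_eq, sdiff_eq_bot_iff.2 h, m_bot, sub_zero]
    exact le_abs_self _
  · rw [h.eq_bot, ← sdiff_eq, h.sdiff_eq_left, m_bot, zero_sub, abs_neg]
    exact le_abs_self _

/-- `level k p > s` iff there are `k` atoms of measure greater than `s` below `p`. -/
theorem lt_level_iff {s : I} (hs : s < 1) (k : ℕ) (p : M) :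
    s < level k p ↔ ∃ F : Finset M, F.card = k ∧ ∀ e ∈ F, e ∈ atoms p ∧ (s : ℝ) < m e := by
  classical
  induction k generalizing p with
  -- `level 0` is constantly `1`, which is why `s < 1` is required.
  | zero => exact ⟨fun _ => ⟨∅, by simp⟩, fun _ => hs⟩
  | succ k ih =>
    -- The strict inequality yields a witness even if the supremum is not attained.
    rw [level, lt_iSup_iff]
    constructor
    · rintro ⟨x, hx⟩
      obtain ⟨h1, h2⟩ := lt_min_iff.1 hx
      obtain ⟨e, he, hse⟩ := exists_atom_of_lt_minGap h1
      obtain ⟨F, hF, h⟩ := (ih _).1 h2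
      have heF : e ∉ F := fun heF => he.1.1 <| disjoint_compl_right.eq_bot_of_le
        (a := e) (b := eᶜ) <| by
          have a1 := (h e heF).1.2.trans inf_le_right
          have a2 := he.2.trans inf_le_right
          exact a1.trans (compl_le_compl a2)
      refine ⟨insert e F, by rw [Finset.card_insert_of_notMem heF, hF], fun f hf => ?_⟩
      rcases Finset.mem_insert.1 hf with rfl | hf
      · exact ⟨atoms_mono inf_le_left he, hse⟩
      · exact ⟨atoms_mono inf_le_left (h f hf).1, (h f hf).2⟩
    · rintro ⟨F, hF, h⟩
      obtain ⟨e, he⟩ : F.Nonempty := Finset.card_pos.1 (by omega)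
      -- The element split off is the atom `e` itself; the other atoms of `F` lie below its
      -- complement.
      refine ⟨e, lt_min ?_ ((ih _).2 ⟨F.erase e, by rw [Finset.card_erase_of_mem he, hF]; rfl,
        fun f hf => ?_⟩)⟩
      · rw [inf_eq_right.2 (h e he).1.2]
        exact lt_of_lt_of_le (h e he).2 (le_minGap_of_isAtom (h e he).1.1)
      · obtain ⟨hfe, hf⟩ := Finset.mem_erase.1 hf
        refine ⟨⟨(h f hf).1.1, le_inf (h f hf).1.2 ?_⟩, (h f hf).2⟩
        exact le_compl_iff_disjoint_right.2 (disjoint_of_isAtom (h f hf).1.1 (h e he).1.1 hfe)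

/-- The atoms below `p` of measure greater than `s`. -/
def largeAtoms (s : ℝ) (p : M) : Set M := {e ∈ atoms p | s < m e}

theorem largeAtoms_anti {s r : ℝ} (h : s ≤ r) (p : M) : largeAtoms r p ⊆ largeAtoms s p :=
  fun _ he => ⟨he.1, h.trans_lt he.2⟩

theorem finite_largeAtoms {s : ℝ} (hs : 0 < s) (p : M) : (largeAtoms s p).Finite := by
  have h := (hasSum_atoms p).summable.tendsto_cofinite_zero.eventually (gt_mem_nhds hs)
  have h' : {e : atoms p | ¬ m (e : M) < s}.Finite := h
  refine (h'.image Subtype.val).subset fun e he => ⟨⟨e, he.1⟩, ?_, rfl⟩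
  exact not_lt.2 he.2.le

end Spectrum

/-! ### The type determines the profile of every cell -/

section Definability

variable {M : Type u} {N : Type v} [PrStructure M] [IsProbAlg M] [PrStructure N] [IsProbAlg N]

theorem ncard_largeAtoms_le {p : M} {q : N} (h : ∀ k, level k p = level k q) {s : ℝ}
    (hs : 0 < s) : (largeAtoms s p).ncard ≤ (largeAtoms s q).ncard := by
  by_cases hs1 : 1 ≤ s
  · have : largeAtoms s p = ∅ := Set.eq_empty_of_forall_notMem fun e he =>
      absurd (m_le_one e) (not_le.2 (hs1.trans_lt he.2))
    simp [this]
  · let s' : I := ⟨s, hs.le, (not_le.1 hs1).le⟩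
    have hs' : s' < 1 := not_le.1 hs1
    have hfin := finite_largeAtoms hs p
    have h1 : s' < level (largeAtoms s p).ncard p := (lt_level_iff hs' _ p).2
      ⟨hfin.toFinset, (Set.ncard_eq_toFinset_card _ hfin).symm, fun e he =>
        hfin.mem_toFinset.1 he⟩
    rw [h] at h1
    obtain ⟨F, hF, hF'⟩ := (lt_level_iff hs' _ q).1 h1
    rw [← hF, ← Set.ncard_coe_finset]
    exact Set.ncard_le_ncard (fun e he => hF' e he) (finite_largeAtoms hs q)

theorem ncard_largeAtoms_eq {p : M} {q : N} (h : ∀ k, level k p = level k q) {s : ℝ}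
    (hs : 0 < s) : (largeAtoms s p).ncard = (largeAtoms s q).ncard :=
  le_antisymm (ncard_largeAtoms_le h hs) (ncard_largeAtoms_le (fun k => (h k).symm) hs)

/-- A threshold just below `r` with no value of `V` strictly between: atoms of measure exactly `r`
become the difference of two sets of large atoms. -/
theorem exists_lt_gapless {V : Set ℝ} (hV : V.Finite) {r : ℝ} (hr : 0 < r) :
    ∃ s, 0 < s ∧ s < r ∧ ∀ v ∈ V, v < r → v ≤ s := by
  have h1 : ∀ᶠ s in nhdsWithin r (Set.Iio r), ∀ v ∈ V, v < r → v ≤ s := by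
    refine (Filter.eventually_all_finite hV).2 fun v _ => ?_
    by_cases hv : v < r
    · filter_upwards [mem_nhdsWithin_of_mem_nhds (lt_mem_nhds hv)] with s hs _ using hs.le
    · exact Filter.Eventually.of_forall fun s h => absurd h hv
  have h0 : ∀ᶠ s in nhdsWithin r (Set.Iio r), 0 < s :=
    mem_nhdsWithin_of_mem_nhds (lt_mem_nhds hr)
  have h0' : ∀ᶠ s in nhdsWithin r (Set.Iio r), s < r := self_mem_nhdsWithin
  obtain ⟨s, h2, h3, h4⟩ := (h1.and (h0.and h0')).exists
  exact ⟨s, h3, h4, h2⟩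

/-- The atoms below `p` of measure `r`. -/
def atomsOfMeasure (r : ℝ) (p : M) : Set M := {e ∈ atoms p | m e = r}

theorem largeAtoms_sdiff {p : M} {r s : ℝ} (hsr : s < r)
    (h : ∀ e ∈ largeAtoms (r / 2) p, m e < r → m e ≤ s) (hs : r / 2 ≤ s) :
    atomsOfMeasure r p = largeAtoms s p \ largeAtoms r p := by
  ext e
  constructor
  · rintro ⟨he, rfl⟩
    exact ⟨⟨he, hsr⟩, fun h => lt_irrefl _ h.2⟩
  · rintro ⟨he, he'⟩
    have h1 : m e ≤ r := not_lt.1 fun h => he' ⟨he.1, h⟩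
    refine ⟨he.1, h1.antisymm (not_lt.1 fun h2 => ?_)⟩
    exact absurd he.2 (not_lt.2 (h e ⟨he.1, hs.trans_lt he.2⟩ h2))

theorem card_atomsOfMeasure {p : M} {q : N} (h : ∀ k, level k p = level k q) {r : ℝ}
    (hr : 0 < r) : (atomsOfMeasure r p).ncard = (atomsOfMeasure r q).ncard := by
  -- One threshold for both sides. Only the finitely many atoms above `r / 2` matter; including `r /
  -- 2` in the set forces `r / 2 ≤ s`.
  obtain ⟨s, hs0, hsr, hs⟩ := exists_lt_gapless
    ((((finite_largeAtoms (half_pos hr) p).image m).union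
      ((finite_largeAtoms (half_pos hr) q).image m)).union (Set.finite_singleton (r / 2))) hr
  have hs2 : r / 2 ≤ s := hs _ (Or.inr rfl) (half_lt_self hr)
  rw [largeAtoms_sdiff hsr (fun e he => hs _ (Or.inl (Or.inl ⟨e, he, rfl⟩))) hs2,
    largeAtoms_sdiff hsr (fun e he => hs _ (Or.inl (Or.inr ⟨e, he, rfl⟩))) hs2,
    Set.ncard_sdiff (largeAtoms_anti hsr.le p) (finite_largeAtoms hr p),
    Set.ncard_sdiff (largeAtoms_anti hsr.le q) (finite_largeAtoms hr q),
    ncard_largeAtoms_eq h hr, ncard_largeAtoms_eq h hs0]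

/-- For each `r` the atoms of measure `r` are finite in number and equinumerous on both sides; the
bijections glue because the measure of an atom says which one to apply. -/
theorem sameProfile_of_level_eq {p : M} {q : N} (hm : m p = m q)
    (h : ∀ k, level k p = level k q) : SameProfile p q := by
  classical
  have hcard : ∀ r : ℝ, ∃ f : M → N, Set.BijOn f (atomsOfMeasure r p) (atomsOfMeasure r q) := by
    intro r
    rcases le_or_gt r 0 with hr | hr
    · have e1 : atomsOfMeasure r p = ∅ := Set.eq_empty_of_forall_notMem fun e he =>
        (m_pos he.1.1.1).not_ge (he.2.le.trans hr)
      have e2 : atomsOfMeasure r q = ∅ := Set.eq_empty_of_forall_notMem fun e he =>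
        (m_pos he.1.1.1).not_ge (he.2.le.trans hr)
      exact ⟨fun _ => ⊥, by rw [e1, e2]; exact Set.bijOn_empty _⟩
    · have f1 : (atomsOfMeasure r p).Finite := (finite_largeAtoms (half_pos hr) p).subset
        fun e he => ⟨he.1, (half_lt_self hr).trans_eq he.2.symm⟩
      have f2 : (atomsOfMeasure r q).Finite := (finite_largeAtoms (half_pos hr) q).subset
        fun e he => ⟨he.1, (half_lt_self hr).trans_eq he.2.symm⟩
      have hc := card_atomsOfMeasure h hr
      have : Nonempty N := ⟨⊥⟩
      refine f1.exists_bijOn_of_encard_eq ?_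
      rw [← f1.cast_ncard_eq, ← f2.cast_ncard_eq, hc]
  choose f hf using hcard
  have hmem : ∀ e ∈ atoms p, f (m e) e ∈ atomsOfMeasure (m e) q := fun e he =>
    (hf (m e)).mapsTo ⟨he, rfl⟩
  refine ⟨hm, fun e => f (m e) e, ⟨fun e he => (hmem e he).1, fun e he e' he' hee' => ?_,
    fun e he => ?_⟩, fun e he => (hmem e he).2⟩
  · have h1 : m e = m e' := by
      rw [← (hmem e he).2, ← (hmem e' he').2]
      exact congrArg m hee'
    refine (hf (m e)).injOn ⟨he, rfl⟩ ⟨he', h1.symm⟩ ?_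
    simp only [← h1] at hee'
    exact hee'
  · obtain ⟨e', he', h⟩ := (hf (m e)).surjOn ⟨he, rfl⟩
    exact ⟨e', he'.1, by simp only [he'.2, h]⟩

/-- The term defining a cell. -/
def cellTerm : {n : ℕ} → (Fin n → Bool) → PrTerm n
  | 0, _ => .one
  | n + 1, ρ => .inter (cellTerm (Fin.init ρ)).lift
      (bif ρ (Fin.last n) then .var (Fin.last n) else .compl (.var (Fin.last n)))

theorem eval_cellTerm {n : ℕ} (a : Fin n → M) (ρ : Fin n → Bool) :
    (cellTerm ρ).eval a = cell a ρ := by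
  induction n with
  | zero => rfl
  | succ n ih =>
    rw [cell, cellTerm, PrTerm.eval, ← ih]
    congr 1
    · conv_lhs => rw [← Fin.snoc_init_self a]
      exact PrTerm.eval_lift _ _ _
    · cases ρ (Fin.last n) <;> rfl

/-- Tuples that satisfy the same formulas are related. -/
theorem rel_of_eval_eq {n : ℕ} {a : Fin n → M} {b : Fin n → N}
    (h : ∀ φ : PrFormula n, φ.eval a = φ.eval b) : Rel a b := fun ρ => by
  refine sameProfile_of_level_eq ?_ fun k => ?_
  · rw [← eval_cellTerm, ← eval_cellTerm]
    exact mu_eq_mu_iff.1 (h (.mu (cellTerm ρ)))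
  · rw [← eval_cellTerm, ← eval_cellTerm, ← eval_levelFormula, ← eval_levelFormula]
    exact h _

end Definability

end ProbAlg

/-! ### Extending a correspondence between dense families -/

namespace ProbAlg

section Position

variable {M : Type u} {N : Type v} [PrStructure M] [PrStructure N]

/-- `x` and `y` are in the same position relative to the families `A` and `B`. -/
def SamePosition {ι : Type*} (A : ι → M) (B : ι → N) (x : M) (y : N) : Prop :=
  ∀ i, dist x (A i) = dist y (B i)

variable {ι : Type*} {A : ι → M} {B : ι → N}

theorem SamePosition.symm {x : M} {y : N} (h : SamePosition A B x y) : SamePosition B A y x :=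
  fun i => (h i).symm

/-- Approximate `x` by members of `A`; the corresponding members of `B` form a Cauchy sequence,
whose limit is the witness. -/
theorem exists_samePosition (hA : DenseRange A)
    (hd : ∀ i j, dist (A i) (A j) = dist (B i) (B j)) (x : M) :
    ∃ y, SamePosition A B x y := by
  obtain ⟨w, hw, hwx⟩ := mem_closure_iff_seq_limit.1 (hA x)
  choose i hi using hw
  obtain rfl : (fun k => A (i k)) = w := funext hi
  have hc : CauchySeq fun k => B (i k) := by
    have := hwx.cauchySeq
    rw [Metric.cauchySeq_iff] at this ⊢
    simpa only [← hd] using this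
  obtain ⟨y, hy⟩ := cauchySeq_tendsto_of_complete hc
  refine ⟨y, fun j => tendsto_nhds_unique (hwx.dist tendsto_const_nhds) ?_⟩
  simpa only [hd] using hy.dist (tendsto_const_nhds (x := B j))

theorem SamePosition.unique (hB : DenseRange B) {x : M} {y y' : N}
    (h : SamePosition A B x y) (h' : SamePosition A B x y') : y = y' := by
  have h1 : ∀ z, dist y z = dist y' z := fun z =>
    hB.induction_on (p := fun z => dist y z = dist y' z) z
      (isClosed_eq (by fun_prop) (by fun_prop)) fun i => by rw [← h i, h' i]
  simpa using h1 y'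

theorem SamePosition.exists_near (hA : DenseRange A) {x : M} {y : N}
    (h : SamePosition A B x y) {ε : ℝ} (hε : 0 < ε) :
    ∃ i, dist x (A i) < ε ∧ dist y (B i) < ε := by
  obtain ⟨i, hi⟩ := hA.exists_dist_lt x hε
  exact ⟨i, hi, h i ▸ hi⟩

/-- The factor `4` is the loss in `SamePosition.inf`: one `ε` for each of the four approximated
elements. -/
theorem eq_of_forall_abs_sub_le {r s : ℝ} (h : ∀ ε > 0, |r - s| ≤ 4 * ε) : r = s :=
  eq_of_abs_sub_le_all fun ε hε => by linarith [h (ε / 4) (by positivity)]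

end Position

section Extension

variable {M : Type u} {N : Type v} [PrStructure M] [IsProbAlg M] [PrStructure N] [IsProbAlg N]
  {ι : Type*} {A : ι → M} {B : ι → N}

theorem SamePosition.m_eq (hA : DenseRange A) (hm : ∀ i, m (A i) = m (B i)) {x : M} {y : N}
    (h : SamePosition A B x y) : m x = m y := by
  refine eq_of_forall_abs_sub_le fun ε hε => ?_
  obtain ⟨i, h1, h2⟩ := h.exists_near hA hε
  have h3 := abs_le.1 (abs_m_sub_le x (A i))
  have h4 := abs_le.1 (abs_m_sub_le y (B i))
  have := hm i
  rw [abs_le]; constructor <;> linarith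

theorem SamePosition.compl (hA : DenseRange A)
    (hc : ∀ i k, dist (A i)ᶜ (A k) = dist (B i)ᶜ (B k)) {x : M} {y : N}
    (h : SamePosition A B x y) : SamePosition A B xᶜ yᶜ := fun k => by
  refine eq_of_forall_abs_sub_le fun ε hε => ?_
  obtain ⟨i, h1, h2⟩ := h.exists_near hA hε
  have h3 := abs_le.1 (abs_dist_sub_le xᶜ (A i)ᶜ (A k))
  have h4 := abs_le.1 (abs_dist_sub_le yᶜ (B i)ᶜ (B k))
  rw [dist_compl] at h3 h4
  have := hc i k
  rw [abs_le]; constructor <;> linarith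

theorem SamePosition.inf (hA : DenseRange A)
    (hi : ∀ i j k, dist (A i ⊓ A j) (A k) = dist (B i ⊓ B j) (B k)) {x x' : M} {y y' : N}
    (h : SamePosition A B x y) (h' : SamePosition A B x' y') :
    SamePosition A B (x ⊓ x') (y ⊓ y') := fun k => by
  refine eq_of_forall_abs_sub_le fun ε hε => ?_
  obtain ⟨i, h1, h2⟩ := h.exists_near hA hε
  obtain ⟨j, h1', h2'⟩ := h'.exists_near hA hε
  have h3 := abs_le.1 (abs_dist_sub_le (x ⊓ x') (A i ⊓ A j) (A k))
  have h4 := abs_le.1 (abs_dist_sub_le (y ⊓ y') (B i ⊓ B j) (B k))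
  have h5 := dist_inf_le x x' (A i) (A j)
  have h6 := dist_inf_le y y' (B i) (B j)
  have := hi i j k
  rw [abs_le]; constructor <;> linarith

/-- A correspondence between dense families that respects the structure extends to an
isomorphism. -/
theorem exists_prIso_of_denseRange (hA : DenseRange A) (hB : DenseRange B)
    (hd : ∀ i j, dist (A i) (A j) = dist (B i) (B j)) (hm : ∀ i, m (A i) = m (B i))
    (hc : ∀ i k, dist (A i)ᶜ (A k) = dist (B i)ᶜ (B k))
    (hi : ∀ i j k, dist (A i ⊓ A j) (A k) = dist (B i ⊓ B j) (B k)) :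
    ∃ g : PrIso M N, ∀ i, g.toFun (A i) = B i := by
  choose g hg using exists_samePosition hA hd
  choose g' hg' using exists_samePosition hB fun i j => (hd i j).symm
  -- Position determines the point, so `g` preserves an operation as soon as the operation preserves
  -- positions.
  have huniq : ∀ {x y}, SamePosition A B x y → g x = y := fun h => (hg _).unique hB h
  have hbot : SamePosition A B ⊥ ⊥ := fun i => by rw [dist_bot_left, dist_bot_left, hm]
  have hcompl : ∀ a, g aᶜ = (g a)ᶜ := fun a => huniq ((hg a).compl hA hc)
  have hinf : ∀ a b, g (a ⊓ b) = g a ⊓ g b := fun a b => huniq ((hg a).inf hA hi (hg b))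
  have hsup : ∀ a b, g (a ⊔ b) = g a ⊔ g b := fun a b => by
    rw [← compl_compl (a ⊔ b), compl_sup, hcompl, hinf, hcompl, hcompl, ← compl_sup, compl_compl]
  have hmg : ∀ a, m (g a) = m a := fun a => ((hg a).m_eq hA hm).symm
  refine ⟨⟨⟨g, g', fun x => ?_, fun y => ?_⟩, huniq hbot, ?_, hcompl, hinf, hsup,
    fun a => mu_eq_mu_iff.2 (hmg a), fun a b => ?_⟩, fun i => huniq fun j => hd i j⟩
  · exact (hg' (g x)).unique hA (hg x).symm
  · exact huniq (hg' y).symm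
  · change g ⊤ = ⊤
    rw [← compl_bot, hcompl, huniq hbot, compl_bot]
  · change dist (g a) (g b) = dist a b
    rw [dist_eq_m, dist_eq_m, symmDiff_eq, symmDiff_eq, ← hmg, hsup, hinf, hinf, hcompl, hcompl]

end Extension

/-! ### Back-and-forth in separable models -/

section BackAndForth

variable {M : Type u} {N : Type v} [PrStructure M] [IsProbAlg M] [PrStructure N] [IsProbAlg N]

/-- The first `n` entries of two sequences are related. -/
def RelUpTo (n : ℕ) (A : ℕ → M) (B : ℕ → N) : Prop :=
  Rel (fun i : Fin n => A i) (fun i : Fin n => B i)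

theorem restrict_update {α : Type*} (n : ℕ) (A : ℕ → α) (c : α) :
    (fun i : Fin (n + 1) => Function.update A n c i) =
      Fin.snoc (α := fun _ => α) (fun i : Fin n => A i) c := by
  funext i
  induction i using Fin.lastCases with
  | last => simp
  | cast i => simp [Function.update_of_ne i.2.ne]

theorem RelUpTo.extend {n : ℕ} {A : ℕ → M} {B : ℕ → N} (h : RelUpTo n A B) (c : M) :
    ∃ A' B', RelUpTo (n + 1) A' B' ∧ (∀ i < n, A' i = A i ∧ B' i = B i) ∧ A' n = c := by
  obtain ⟨d, hd⟩ := Rel.extend h c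
  refine ⟨Function.update A n c, Function.update B n d, ?_, fun i hi => ?_, by simp⟩
  · rw [RelUpTo, restrict_update, restrict_update]
    exact hd
  · exact ⟨Function.update_of_ne hi.ne _ _, Function.update_of_ne hi.ne _ _⟩

/-- One forth step places `c` at index `n` on the left, then one back step places `d` at index `n +
1` on the right. -/
theorem RelUpTo.extend_both {n : ℕ} {A : ℕ → M} {B : ℕ → N} (h : RelUpTo n A B) (c : M) (d : N) :
    ∃ A' B', RelUpTo (n + 2) A' B' ∧ (∀ i < n, A' i = A i ∧ B' i = B i) ∧ A' n = c ∧
      B' (n + 1) = d := by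
  obtain ⟨A', B', h1, h2, h3⟩ := h.extend c
  obtain ⟨B'', A'', h4, h5, h6⟩ := RelUpTo.extend (Rel.symm h1) d
  refine ⟨A'', B'', Rel.symm h4, fun i hi => ?_, ?_, h6⟩
  · rw [(h5 i (by omega)).1, (h5 i (by omega)).2]
    exact h2 i hi
  · rw [(h5 n (by omega)).2, h3]

theorem RelUpTo.mono_eq {n : ℕ} {A A' : ℕ → M} {B B' : ℕ → N} (h : RelUpTo n A B)
    (h' : ∀ i < n, A' i = A i ∧ B' i = B i) : RelUpTo n A' B' := by
  have h1 : (fun i : Fin n => A' i) = fun i : Fin n => A i := funext fun i => (h' i i.2).1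
  have h2 : (fun i : Fin n => B' i) = fun i : Fin n => B i := funext fun i => (h' i i.2).2
  rw [RelUpTo, h1, h2]
  exact h

theorem RelUpTo.exists_sequences {n : ℕ} {A : ℕ → M} {B : ℕ → N} (h : RelUpTo n A B)
    (x : ℕ → M) (y : ℕ → N) : ∃ A' B', (∀ k, RelUpTo (n + 2 * k) A' B') ∧
      (∀ i < n, A' i = A i ∧ B' i = B i) ∧ Set.range x ⊆ Set.range A' ∧
      Set.range y ⊆ Set.range B' := by
  let St (k : ℕ) := {P : (ℕ → M) × (ℕ → N) // RelUpTo (n + 2 * k) P.1 P.2}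
  have hstep : ∀ k (P : St k), ∃ Q : St (k + 1),
      (∀ i < n + 2 * k, Q.1.1 i = P.1.1 i ∧ Q.1.2 i = P.1.2 i) ∧
      Q.1.1 (n + 2 * k) = x k ∧ Q.1.2 (n + 2 * k + 1) = y k := fun k P => by
    obtain ⟨A', B', h1, h2, h3, h4⟩ := P.2.extend_both (x k) (y k)
    exact ⟨⟨(A', B'), h1⟩, h2, h3, h4⟩
  choose next hnext hx hy using hstep
  let s : ∀ k, St k := fun k => Nat.rec ⟨(A, B), h⟩ (fun k P => next k P) k
  have hcoh : ∀ k l, k ≤ l → ∀ i < n + 2 * k,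
      (s l).1.1 i = (s k).1.1 i ∧ (s l).1.2 i = (s k).1.2 i := by
    intro k l hkl i hi
    induction l, hkl using Nat.le_induction with
    | base => exact ⟨rfl, rfl⟩
    | succ l hl ih =>
      have := hnext l (s l) i (by omega)
      exact ⟨this.1.trans ih.1, this.2.trans ih.2⟩
  -- Entries below `n + 2 * k` are final from stage `k` on, and `i < n + 2 * (i + 1)`, so entry `i`
  -- can be read off at stage `i + 1`.
  have hdiag : ∀ k, ∀ i < n + 2 * k,
      (s (i + 1)).1.1 i = (s k).1.1 i ∧ (s (i + 1)).1.2 i = (s k).1.2 i := fun k i hi => by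
    rcases le_total k (i + 1) with hk | hk
    · exact hcoh k _ hk i hi
    · have := hcoh _ k hk i (by omega)
      exact ⟨this.1.symm, this.2.symm⟩
  refine ⟨fun i => (s (i + 1)).1.1 i, fun i => (s (i + 1)).1.2 i,
    fun k => (s k).2.mono_eq (hdiag k), fun i hi => hdiag 0 i (by omega), ?_, ?_⟩
  · rintro _ ⟨k, rfl⟩
    exact ⟨n + 2 * k, (hdiag (k + 1) _ (by omega)).1.trans (hx k (s k))⟩
  · rintro _ ⟨k, rfl⟩
    exact ⟨n + 2 * k + 1, (hdiag (k + 1) _ (by omega)).2.trans (hy k (s k))⟩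

/-- Related tuples in separable probability algebras are conjugate. -/
theorem Rel.exists_prIso [TopologicalSpace.SeparableSpace M] [TopologicalSpace.SeparableSpace N]
    {n : ℕ} {a : Fin n → M} {b : Fin n → N} (h : Rel a b) :
    ∃ g : PrIso M N, ∀ i, g.toFun (a i) = b i := by
  have : Nonempty M := ⟨⊥⟩
  have : Nonempty N := ⟨⊥⟩
  -- The padding `⊥` is arbitrary: `RelUpTo n` sees only the first `n` entries.
  let A₀ : ℕ → M := fun i => if hi : i < n then a ⟨i, hi⟩ else ⊥
  let B₀ : ℕ → N := fun i => if hi : i < n then b ⟨i, hi⟩ else ⊥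
  have h₀ : RelUpTo n A₀ B₀ := by simpa [RelUpTo, A₀, B₀] using h
  obtain ⟨A, B, hAB, hinit, hxA, hyB⟩ :=
    h₀.exists_sequences (TopologicalSpace.denseSeq M) (TopologicalSpace.denseSeq N)
  have hA : DenseRange A := (TopologicalSpace.denseRange_denseSeq M).mono hxA
  have hB : DenseRange B := (TopologicalSpace.denseRange_denseSeq N).mono hyB
  have hterm : ∀ i j k : ℕ, ∃ n', ∃ hi : i < n', ∃ hj : j < n', ∃ hk : k < n', RelUpTo n' A B :=
    fun i j k => ⟨n + 2 * (i + j + k + 1), by omega, by omega, by omega, hAB _⟩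
  obtain ⟨g, hg⟩ := exists_prIso_of_denseRange hA hB
    (fun i j => by
      obtain ⟨n', hi, hj, -, h⟩ := hterm i j 0
      exact Rel.dist_eval_eq h (.var ⟨i, hi⟩) (.var ⟨j, hj⟩))
    (fun i => by
      obtain ⟨n', hi, -, -, h⟩ := hterm i 0 0
      exact Rel.m_eval_eq h (.var ⟨i, hi⟩))
    (fun i k => by
      obtain ⟨n', hi, hk, -, h⟩ := hterm i k 0
      exact Rel.dist_eval_eq h (.compl (.var ⟨i, hi⟩)) (.var ⟨k, hk⟩))
    (fun i j k => by
      obtain ⟨n', hi, hj, hk, h⟩ := hterm i j k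
      exact Rel.dist_eval_eq h (.inter (.var ⟨i, hi⟩) (.var ⟨j, hj⟩)) (.var ⟨k, hk⟩))
  refine ⟨g, fun i => ?_⟩
  have h1 := hg i
  rw [(hinit i i.2).1, (hinit i i.2).2] at h1
  simpa [A₀, B₀] using h1

end BackAndForth

end ProbAlg

/-! ### A separable subalgebra with the same atoms -/

/-- A closed subset that is closed under the operations is a structure. -/
abbrev PrStructure.ofClosedSubset {M : Type u} [PrStructure M] {S : Set M} (hS : IsClosed S)
    (h0 : PrStructure.zero ∈ S) (h1 : PrStructure.one ∈ S)
    (hc : ∀ a ∈ S, PrStructure.compl a ∈ S) (hi : ∀ a ∈ S, ∀ b ∈ S, PrStructure.inter a b ∈ S)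
    (hu : ∀ a ∈ S, ∀ b ∈ S, PrStructure.union a b ∈ S) : PrStructure S where
  __ := (inferInstance : MetricSpace S)
  complete := by
    have : CompleteSpace M := PrStructure.complete
    exact hS.completeSpace_coe
  dist_le_one a b := PrStructure.dist_le_one (a : M) b
  zero := ⟨PrStructure.zero, h0⟩
  one := ⟨PrStructure.one, h1⟩
  compl a := ⟨PrStructure.compl a, hc a a.2⟩
  inter a b := ⟨PrStructure.inter a b, hi a a.2 b b.2⟩
  union a b := ⟨PrStructure.union a b, hu a a.2 b b.2⟩
  mu a := PrStructure.mu (a : M)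
  compl_modulus ε h h' a b := PrStructure.compl_modulus ε h h' (a : M) b
  inter_modulus ε h h' a b a' b' := PrStructure.inter_modulus ε h h' (a : M) b a' b'
  union_modulus ε h h' a b a' b' := PrStructure.union_modulus ε h h' (a : M) b a' b'
  mu_modulus ε h h' a b := PrStructure.mu_modulus ε h h' (a : M) b

namespace ProbAlg

section Separable

variable {M : Type u} [PrStructure M] [IsProbAlg M]

theorem exists_countable_subalgebra {G : Set M} (hG : G.Countable) : ∃ S : Set M, S.Countable ∧
    G ⊆ S ∧ ⊥ ∈ S ∧ (∀ a ∈ S, aᶜ ∈ S) ∧ ∀ a ∈ S, ∀ b ∈ S, a ⊓ b ∈ S := by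
  let s : ℕ → Set M := fun n => Nat.rec (insert ⊥ G)
    (fun _ T => T ∪ (compl '' T ∪ Set.image2 (· ⊓ ·) T T)) n
  have hmono : Monotone s := monotone_nat_of_le_succ fun n => Set.subset_union_left
  refine ⟨⋃ n, s n, Set.countable_iUnion fun n => ?_, fun x hx => ?_, ?_, fun a ha => ?_,
    fun a ha b hb => ?_⟩
  · induction n with
    | zero => exact hG.insert _
    | succ n ih => exact ih.union ((ih.image _).union (ih.image2 ih _))
  · exact Set.mem_iUnion.2 ⟨0, Set.mem_insert_of_mem _ hx⟩
  · exact Set.mem_iUnion.2 ⟨0, Set.mem_insert _ _⟩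
  · obtain ⟨n, hn⟩ := Set.mem_iUnion.1 ha
    exact Set.mem_iUnion.2 ⟨n + 1, Or.inr (Or.inl ⟨a, hn, rfl⟩)⟩
  · obtain ⟨n, hn⟩ := Set.mem_iUnion.1 ha
    obtain ⟨k, hk⟩ := Set.mem_iUnion.1 hb
    exact Set.mem_iUnion.2 ⟨max n k + 1, Or.inr (Or.inr
      ⟨a, hmono (le_max_left n k) hn, b, hmono (le_max_right n k) hk, rfl⟩)⟩

theorem exists_separable_subalgebra {G : Set M} (hG : G.Countable) : ∃ S : Set M,
    TopologicalSpace.IsSeparable S ∧ IsClosed S ∧ G ⊆ S ∧ ⊥ ∈ S ∧ (∀ a ∈ S, aᶜ ∈ S) ∧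
    ∀ a ∈ S, ∀ b ∈ S, a ⊓ b ∈ S := by
  obtain ⟨S, hS, hGS, h0, hc, hi⟩ := exists_countable_subalgebra hG
  exact ⟨closure S, hS.isSeparable.closure, isClosed_closure, hGS.trans subset_closure,
    subset_closure h0, fun a ha => map_mem_closure uniformContinuous_compl.continuous ha hc,
    fun a ha b hb => map_mem_closure₂ uniformContinuous_inf.continuous ha hb hi⟩

/-- A closed subalgebra is a probability algebra in its own right. -/
theorem exists_embedding {S : Set M} (hScl : IsClosed S) (h0 : ⊥ ∈ S) (hc : ∀ a ∈ S, aᶜ ∈ S)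
    (hi : ∀ a ∈ S, ∀ b ∈ S, a ⊓ b ∈ S) :
    ∃ (N : Type u) (_ : PrStructure N) (_ : IsProbAlg N) (f : N → M), Function.Injective f ∧
      Set.range f = S ∧ (∀ a b, f (a ⊓ b) = f a ⊓ f b) ∧ f ⊥ = ⊥ ∧ (∀ a, m (f a) = m a) ∧
      (TopologicalSpace.IsSeparable S → TopologicalSpace.SeparableSpace N) := by
  have hu : ∀ a ∈ S, ∀ b ∈ S, a ⊔ b ∈ S := fun a ha b hb => by
    have := hc _ (hi _ (hc a ha) _ (hc b hb))
    rwa [compl_inf, compl_compl, compl_compl] at this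
  have h1 : ⊤ ∈ S := by simpa using hc _ h0
  let inst : PrStructure S := PrStructure.ofClosedSubset hScl h0 h1 hc hi hu
  have hN : IsProbAlg S :=
    { union_comm := fun a b => Subtype.ext (IsProbAlg.union_comm _ _)
      inter_comm := fun a b => Subtype.ext (IsProbAlg.inter_comm _ _)
      union_assoc := fun a b c => Subtype.ext (IsProbAlg.union_assoc _ _ _)
      inter_assoc := fun a b c => Subtype.ext (IsProbAlg.inter_assoc _ _ _)
      union_absorb := fun a b => Subtype.ext (IsProbAlg.union_absorb _ _)
      inter_absorb := fun a b => Subtype.ext (IsProbAlg.inter_absorb _ _)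
      inter_union := fun a b c => Subtype.ext (IsProbAlg.inter_union _ _ _)
      union_inter := fun a b c => Subtype.ext (IsProbAlg.union_inter _ _ _)
      union_zero := fun a => Subtype.ext (IsProbAlg.union_zero _)
      inter_one := fun a => Subtype.ext (IsProbAlg.inter_one _)
      union_compl := fun a => Subtype.ext (IsProbAlg.union_compl _)
      inter_compl := fun a => Subtype.ext (IsProbAlg.inter_compl _)
      mu_zero := IsProbAlg.mu_zero (M := M)
      mu_one := IsProbAlg.mu_one (M := M)
      mu_inter_le := fun a b => IsProbAlg.mu_inter_le (a : M) b
      le_mu_union := fun a b => IsProbAlg.le_mu_union (a : M) b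
      mu_modular := fun a b => IsProbAlg.mu_modular (a : M) b
      dist_eq := fun a b => IsProbAlg.dist_eq (a : M) b }
  exact ⟨S, inst, hN, Subtype.val, Subtype.val_injective, Subtype.range_coe, fun _ _ => rfl, rfl,
    fun _ => rfl, fun h => h.separableSpace⟩

/-- Every probability algebra has a separable subalgebra with the same atoms. -/
theorem exists_separable_rel (M : Type u) [PrStructure M] [IsProbAlg M] :
    ∃ (N : Type u) (_ : PrStructure N) (_ : IsProbAlg N), TopologicalSpace.SeparableSpace N ∧
      Rel (Fin.elim0 : Fin 0 → N) (Fin.elim0 : Fin 0 → M) := by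
  obtain ⟨γ, hγc, hγ⟩ := exists_path (p := cont M) fun e he => not_le_cont he
  obtain ⟨S, hSsep, hScl, hGS, h0, hc, hi⟩ := exists_separable_subalgebra
    (G := γ '' Set.range ((↑) : ℚ → ℝ) ∪ atoms ⊤)
    (((Set.countable_range _).image γ).union countable_atoms)
  have hγS : ∀ t, γ t ∈ S := fun t => by
    have h2 : γ t ∈ closure (γ '' Set.range ((↑) : ℚ → ℝ)) :=
      map_mem_closure hγc (Rat.denseRange_cast (𝕜 := ℝ) t) fun _ => Set.mem_image_of_mem γ
    exact hScl.closure_subset_iff.2 (Set.subset_union_left.trans hGS) h2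
  -- The path prevents new atoms: `m (e ⊓ γ t)` varies continuously from `0` to `m e`, so some `e ⊓
  -- γ t`, again in `S`, has half the measure of `e`.
  have hdiv : ∀ e ∈ S, e ≤ cont M → e ≠ ⊥ → ∃ z ∈ S, z ≤ e ∧ z ≠ ⊥ ∧ z ≠ e := by
    intro e he hle hne
    have hpos := m_pos hne
    have hf : ContinuousOn (fun t => m (e ⊓ γ t)) (Set.Icc 0 (m (cont M))) :=
      (lipschitzWith_m.continuous.comp (continuous_const.inf hγc)).continuousOn
    have hγ0 := hγ 0 ⟨le_rfl, m_nonneg _⟩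
    have hγ1 := hγ (m (cont M)) ⟨m_nonneg _, le_rfl⟩
    obtain ⟨t, -, ht⟩ := intermediate_value_Icc (m_nonneg (cont M)) hf
      (show m e / 2 ∈ Set.Icc _ _ by
        rw [eq_bot_of_m_eq_zero hγ0.2, eq_of_le_of_m_le hγ1.1 hγ1.2.ge, inf_bot_eq, m_bot,
          inf_eq_left.2 hle]
        constructor <;> linarith)
    simp only at ht
    refine ⟨e ⊓ γ t, hi e he _ (hγS t), inf_le_left, fun h => ?_, fun h => ?_⟩ <;> rw [h] at ht
    · rw [m_bot] at ht; linarith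
    · linarith
  obtain ⟨N, _, _, f, hf, rfl, hfi, hf0, hfm, hsep⟩ := exists_embedding hScl h0 hc hi
  have hle : ∀ x y : N, x ≤ y ↔ f x ≤ f y := fun x y => by
    rw [← inf_eq_left, ← inf_eq_left, ← hfi, hf.eq_iff]
  have hbot : ∀ x : N, x = ⊥ ↔ f x = ⊥ := fun x => by rw [← hf0, hf.eq_iff]
  have hatom : ∀ x : N, IsAtom x ↔ IsAtom (f x) := by
    intro x
    constructor
    · intro hx
      have hxne : f x ≠ ⊥ := fun h => hx.1 ((hbot x).2 h)
      -- An atom of `N` disjoint from all atoms of `M` would lie below `cont M` and be divisible. So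
      -- it contains an atom of `M`, which belongs to the subalgebra and must equal it.
      obtain ⟨e, he, hex⟩ : ∃ e ∈ atoms (⊤ : M), ¬ Disjoint e (f x) := by
        by_contra! hcon
        have hxle : f x ≤ cont M := by
          rw [← disjoint_compl_right_iff]
          exact (disjoint_isLUB isLUB_atoms_top hcon).symm
        obtain ⟨_, ⟨z, rfl⟩, hzx, hz0, hzne⟩ := hdiv _ ⟨x, rfl⟩ hxle hxne
        rcases hx.le_iff.1 ((hle z x).2 hzx) with h | h
        · exact hz0 ((hbot _).1 h)
        · exact hzne (congrArg f h)
      obtain ⟨e, rfl⟩ := hGS (Or.inr he)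
      have hle' := (le_or_disjoint_of_isAtom he.1 (f x)).resolve_right hex
      rcases hx.le_iff.1 ((hle e x).2 hle') with h | h
      · exact absurd ((hbot _).1 h) he.1.1
      · rw [← h]; exact he.1
    · intro hx
      refine ⟨fun h => hx.1 ((hbot x).1 h), fun z hz => ?_⟩
      rcases hx.le_iff.1 ((hle z x).1 hz.le) with h | h
      · exact (hbot z).2 h
      · exact absurd (hf h) hz.ne
  refine ⟨N, inferInstance, inferInstance, hsep hSsep, fun ρ => ?_⟩
  -- The only cell of the empty tuple is `⊤`.
  refine ⟨(m_top (M := N)).trans (m_top (M := M)).symm, f,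
    ⟨fun e he => ⟨(hatom e).1 he.1, le_top⟩, hf.injOn, fun e he => ?_⟩, fun e _ => hfm e⟩
  obtain ⟨e, rfl⟩ := hGS (Or.inr ⟨he.1, le_top⟩)
  exact ⟨e, ⟨(hatom _).2 he.1, le_top⟩, rfl⟩

end Separable

end ProbAlg

/-! ### Uniform continuity of formulas -/

/-- The maximum of two numbers as a connective. -/
def connMax : C(Fin 2 → I, I) where
  toFun x := max (x 0) (x 1)
  continuous_toFun := by fun_prop

/-- Finitely many formulas have a maximum. -/
theorem PrFormula.exists_finset_max (M : Type u) [PrStructure M] {n : ℕ}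
    (F : Finset (PrFormula n)) : ∃ ψ : PrFormula n, ∀ (a : Fin n → M) (r : I),
      ψ.eval a ≤ r ↔ ∀ φ ∈ F, φ.eval a ≤ r := by
  classical
  induction F using Finset.induction_on with
  | empty => exact ⟨.conn (.const (Fin 0 → I) 0) Fin.elim0, fun a r =>
      ⟨fun _ φ hφ => absurd hφ (Finset.notMem_empty φ), fun _ => show (0 : I) ≤ r from r.2.1⟩⟩
  | insert φ F _ ih =>
    obtain ⟨ψ, hψ⟩ := ih
    refine ⟨.conn connMax ![φ, ψ], fun a r => ?_⟩
    rw [Finset.forall_mem_insert, ← hψ]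
    exact max_le_iff

namespace ProbAlg

section UniformContinuity

theorem dist_iSup_le {ι : Type*} {f g : ι → I} {ε : ℝ} (h : ∀ i, dist (f i) (g i) ≤ ε)
    (hε : 0 ≤ ε) : dist (⨆ i, f i) (⨆ i, g i) ≤ ε := by
  have key : ∀ f g : ι → I, (∀ i, dist (f i) (g i) ≤ ε) →
      ((⨆ i, f i : I) : ℝ) ≤ (⨆ i, g i : I) + ε := by
    intro f g h
    have h0 := (⨆ i, g i : I).2.1
    have : (⨆ i, f i) ≤ (⟨min 1 ((⨆ i, g i : I) + ε), le_min zero_le_one (by linarith),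
        min_le_left _ _⟩ : I) := iSup_le fun i => le_min (f i).2.2 (by
      have h1 : (g i : ℝ) ≤ (⨆ i, g i : I) := le_iSup g i
      have h2 := (abs_le.1 ((Subtype.dist_eq _ _ : dist (f i) (g i) = _) ▸ h i)).2
      linarith)
    exact (show ((⨆ i, f i : I) : ℝ) ≤ min 1 ((⨆ i, g i : I) + ε) from this).trans
      (min_le_right _ _)
  rw [Subtype.dist_eq, Real.dist_eq, abs_le]
  have h1 := key f g h
  have h2 := key g f fun i => by rw [dist_comm]; exact h i
  constructor <;> linarith

theorem dist_iInf_le {ι : Type*} {f g : ι → I} {ε : ℝ} (h : ∀ i, dist (f i) (g i) ≤ ε)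
    (hε : 0 ≤ ε) : dist (⨅ i, f i) (⨅ i, g i) ≤ ε := by
  have key : ∀ f g : ι → I, (∀ i, dist (f i) (g i) ≤ ε) →
      ((⨅ i, f i : I) : ℝ) - ε ≤ (⨅ i, g i : I) := by
    intro f g h
    have h0 := (⨅ i, f i : I).2.2
    have : (⟨max 0 ((⨅ i, f i : I) - ε), le_max_left _ _, max_le zero_le_one (by linarith)⟩ : I) ≤
        ⨅ i, g i := le_iInf fun i => max_le (g i).2.1 (by
      have h1 : ((⨅ i, f i : I) : ℝ) ≤ f i := iInf_le f i
      have h2 := (abs_le.1 ((Subtype.dist_eq _ _ : dist (f i) (g i) = _) ▸ h i)).2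
      linarith)
    exact (le_max_right _ _).trans
      (show max 0 (((⨅ i, f i : I) : ℝ) - ε) ≤ (⨅ i, g i : I) from this)
  rw [Subtype.dist_eq, Real.dist_eq, abs_le]
  have h1 := key f g h
  have h2 := key g f fun i => by rw [dist_comm]; exact h i
  constructor <;> linarith

theorem dist_snoc_le {M : Type u} [PseudoMetricSpace M] {n : ℕ} (a a' : Fin n → M) (c : M) :
    dist (Fin.snoc a c : Fin (n + 1) → M) (Fin.snoc a' c) ≤ dist a a' := by
  refine (dist_pi_le_iff dist_nonneg).2 fun i => ?_
  induction i using Fin.lastCases with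
  | last => simp
  | cast i => simpa using dist_le_pi_dist a a' i

variable {M : Type u} [PrStructure M] [IsProbAlg M]

theorem uniformContinuous_termEval {n : ℕ} (t : PrTerm n) :
    UniformContinuous fun a : Fin n → M => t.eval a := by
  induction t with
  | var i => exact Pi.uniformContinuous_proj (fun _ => M) i
  | zero => exact uniformContinuous_const
  | one => exact uniformContinuous_const
  | compl t ih => exact uniformContinuous_compl.comp ih
  | inter t s iht ihs => exact uniformContinuous_inf.comp (iht.prodMk ihs)
  | union t s iht ihs => exact uniformContinuous_sup.comp (iht.prodMk ihs)

/-- Uniformity carries the induction through quantifiers, where one `δ` must serve all values of the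
bound variable; connectives are uniformly continuous because the cube is compact. -/
theorem uniformContinuous_eval {n : ℕ} (φ : PrFormula n) :
    UniformContinuous fun a : Fin n → M => φ.eval a := by
  induction φ with
  | mu t =>
    exact (lipschitzWith_m.uniformContinuous.comp (uniformContinuous_termEval t)).subtype_mk _
  | d t s =>
    exact ((uniformContinuous_termEval t).dist (uniformContinuous_termEval s)).subtype_mk _
  | conn f φ ih =>
    exact (CompactSpace.uniformContinuous_of_continuous f.continuous).comp
      (uniformContinuous_pi.2 ih)
  | sup φ ih =>
    rw [Metric.uniformContinuous_iff] at ih ⊢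
    intro ε hε
    obtain ⟨δ, hδ, h⟩ := ih (ε / 2) (half_pos hε)
    exact ⟨δ, hδ, fun {a a'} haa => (dist_iSup_le
      (fun c => (h ((dist_snoc_le a a' c).trans_lt haa)).le) (half_pos hε).le).trans_lt
      (half_lt_self hε)⟩
  | inf φ ih =>
    rw [Metric.uniformContinuous_iff] at ih ⊢
    intro ε hε
    obtain ⟨δ, hδ, h⟩ := ih (ε / 2) (half_pos hε)
    exact ⟨δ, hδ, fun {a a'} haa => (dist_iInf_le
      (fun c => (h ((dist_snoc_le a a' c).trans_lt haa)).le) (half_pos hε).le).trans_lt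
      (half_lt_self hε)⟩

end UniformContinuity

/-! ### Compactness and saturation -/

section Compactness

variable {M : Type u} [PrStructure M] [IsProbAlg M]

/-- Least upper bounds of sets of atoms depend continuously on the set. -/
theorem exists_continuous_join_atoms : ∃ J : (atoms (⊤ : M) → Bool) → M, Continuous J ∧
    ∀ S, IsLUB (Subtype.val '' {e | S e = true}) (J S) := by
  choose J hJ using fun S : atoms (⊤ : M) → Bool =>
    (exists_isLUB (Subtype.val '' {e | S e = true}))
  refine ⟨J, ?_, fun S => (hJ S).1⟩
  rw [continuous_iff_continuousAt]
  intro S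
  rw [ContinuousAt, Metric.tendsto_nhds]
  intro ε hε
  -- Finitely many atoms exhaust the atomic part up to `ε`. Sets of atoms agreeing on `F`, a
  -- neighbourhood in the product topology, have joins differing only in the remainder.
  obtain ⟨F, hF, hFε⟩ := exists_finset_of_isLUB (isLUB_atoms_top (M := M)) hε
  have hev : ∀ᶠ S' in nhds S, ∀ e ∈ {e : atoms (⊤ : M) | (e : M) ∈ F}, S' e = S e := by
    refine (Filter.eventually_all_finite
      (F.finite_toSet.preimage Subtype.val_injective.injOn)).2 fun e _ => ?_
    exact ((continuous_apply e).tendsto S).eventually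
      ((isOpen_discrete {S e}).mem_nhds rfl)
  filter_upwards [hev] with S' hS'
  have hFle : F.sup id ≤ (cont M)ᶜ := Finset.sup_le fun e he => isLUB_atoms_top.1 (hF he)
  have key : ∀ S S' : atoms (⊤ : M) → Bool,
      (∀ e ∈ {e : atoms (⊤ : M) | (e : M) ∈ F}, S' e = S e) →
      J S \ J S' ≤ (cont M)ᶜ \ F.sup id := by
    intro S S' h
    refine le_sdiff.2 ⟨sdiff_le.trans ((hJ S).1.2 ?_), ?_⟩
    · rintro _ ⟨e, -, rfl⟩
      exact isLUB_atoms_top.1 e.2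
    · refine Finset.disjoint_sup_right.2 fun e he => ?_
      have heA := hF he
      have := h ⟨e, heA⟩ he
      by_cases hS : S ⟨e, heA⟩ = true
      · exact disjoint_sdiff_self_left.mono_right ((hJ S').1.1 ⟨_, this.trans hS, rfl⟩)
      · refine Disjoint.mono_left sdiff_le (disjoint_isLUB (hJ S).1 ?_)
        rintro _ ⟨f, hf, rfl⟩
        refine disjoint_of_isAtom f.2.1 heA.1 fun hfe => hS ?_
        obtain rfl : f = ⟨e, heA⟩ := Subtype.ext hfe
        exact hf
  rw [dist_eq_m, symmDiff]
  have h1 := m_mono (sup_le (key S' S fun e he => (hS' e he).symm) (key S S' hS'))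
  rw [m_sdiff_of_le hFle] at h1
  linarith

/-- Over a tuple `a`, every element is related to an element of a fixed compact set. -/
theorem exists_isCompact_rel {n : ℕ} (a : Fin n → M) : ∃ K : Set M, IsCompact K ∧
    ∀ c, ∃ k ∈ K, Rel (Fin.snoc a c : Fin (n + 1) → M) (Fin.snoc a k : Fin (n + 1) → M) := by
  classical
  obtain ⟨J, hJc, hJ⟩ := exists_continuous_join_atoms (M := M)
  choose γ hγc hγ using fun ρ : Fin n → Bool => exists_path (p := cell a ρ ⊓ cont M)
    fun e he h => not_le_cont he (h.trans inf_le_right)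
  -- Up to `Rel` over `a`, an element is given by the atoms below it and the measure of its atomless
  -- part in each cell. These data range over a compact space, and `F` rebuilds an element from them
  -- continuously.
  let F : (atoms (⊤ : M) → Bool) × ((Fin n → Bool) → ℝ) → M := fun P =>
    J P.1 ⊔ Finset.univ.sup fun ρ => γ ρ (P.2 ρ)
  have hF : Continuous F := (hJc.comp continuous_fst).sup
    (Continuous.finset_sup_apply fun ρ _ =>
      (hγc ρ).comp ((continuous_apply ρ).comp continuous_snd))
  refine ⟨F '' (Set.univ ×ˢ Set.pi Set.univ fun ρ => Set.Icc 0 (m (cell a ρ ⊓ cont M))),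
    (isCompact_univ.prod (isCompact_univ_pi fun ρ => isCompact_Icc)).image hF, fun c => ?_⟩
  let S : atoms (⊤ : M) → Bool := fun e => decide ((e : M) ≤ c)
  let t : (Fin n → Bool) → ℝ := fun ρ => m (cell a ρ ⊓ c ⊓ cont M)
  have ht : ∀ ρ, t ρ ∈ Set.Icc 0 (m (cell a ρ ⊓ cont M)) := fun ρ =>
    ⟨m_nonneg _, m_mono (inf_le_inf_right _ inf_le_left)⟩
  refine ⟨F (S, t), ⟨(S, t), ⟨Set.mem_univ _, fun ρ _ => ht ρ⟩, rfl⟩, ?_⟩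
  set k := F (S, t) with hk
  have hγle : ∀ ρ, γ ρ (t ρ) ≤ cell a ρ := fun ρ => (hγ ρ _ (ht ρ)).1.trans inf_le_left
  have hγcont : (Finset.univ.sup fun ρ => γ ρ (t ρ)) ≤ cont M :=
    Finset.sup_le fun ρ _ => (hγ ρ _ (ht ρ)).1.trans inf_le_right
  have hJsub : Subtype.val '' {e | S e = true} ⊆ atoms (⊤ : M) := by
    rintro _ ⟨e, -, rfl⟩; exact e.2
  have hatom : ∀ e : M, IsAtom e → (e ≤ k ↔ e ≤ c) := fun e he => by
    constructor
    · intro h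
      rcases le_or_disjoint_of_isAtom he (J S) with h1 | h1
      · obtain ⟨e', he', rfl⟩ := mem_of_le_isLUB hJsub (hJ S) he h1
        simpa [S] using he'
      · exact absurd ((h1.left_le_of_le_sup_left h).trans hγcont) (not_le_cont he)
    · exact fun h => ((hJ S).1 ⟨⟨e, he, le_top⟩, by simpa [S] using h, rfl⟩).trans le_sup_left
  have hJcont : Disjoint (J S) (cont M) :=
    disjoint_isLUB (hJ S) fun e he => disjoint_cont_of_isAtom (hJsub he).1
  have hatoms : ∀ ρ, atoms (cell a ρ ⊓ c) = atoms (cell a ρ ⊓ k) := fun ρ => by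
    ext e
    simp only [atoms, Set.mem_ofPred_eq, le_inf_iff]
    exact and_congr_right fun he => by rw [hatom e he]
  have hatoms' : ∀ ρ, atoms (cell a ρ ⊓ cᶜ) = atoms (cell a ρ ⊓ kᶜ) := fun ρ => by
    ext e
    simp only [atoms, Set.mem_ofPred_eq, le_inf_iff]
    refine and_congr_right fun he => and_congr_right fun _ => ?_
    have hiff : ∀ x : M, e ≤ xᶜ ↔ ¬ e ≤ x := fun x => by
      rw [le_compl_iff_disjoint_right]
      exact ⟨fun h h' => he.1 (h.eq_bot_of_le h'), (le_or_disjoint_of_isAtom he x).resolve_left⟩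
    rw [hiff, hiff, hatom e he]
  have hm : ∀ ρ, m (cell a ρ ⊓ c) = m (cell a ρ ⊓ k) := fun ρ => by
    -- The atomic parts coincide because both are the join of the same atoms; the atomless parts
    -- both have measure `t ρ`.
    have h1 : (cell a ρ ⊓ c) \ cont M = (cell a ρ ⊓ k) \ cont M :=
      (isLUB_atoms _).unique (hatoms ρ ▸ isLUB_atoms _)
    have h2 : cell a ρ ⊓ k ⊓ cont M = γ ρ (t ρ) := by
      have h3 : k ⊓ cont M = Finset.univ.sup fun ρ => γ ρ (t ρ) := by
        rw [hk, inf_sup_right, hJcont.eq_bot, bot_sup_eq, inf_eq_left.2 hγcont]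
      rw [inf_assoc, h3, cell_inf_sup a hγle]
    rw [← m_inf_add_m_sdiff _ (cont M), ← m_inf_add_m_sdiff (cell a ρ ⊓ k) (cont M), h1, h2,
      (hγ ρ _ (ht ρ)).2]
  intro ρ
  rw [cell_snoc, cell_snoc]
  cases ρ (Fin.last n)
  · refine SameProfile.of_atoms_eq ?_ (hatoms' _)
    have h1 := m_inf_add_m_sdiff (cell a (Fin.init ρ)) c
    have h2 := m_inf_add_m_sdiff (cell a (Fin.init ρ)) k
    rw [sdiff_eq] at h1 h2
    have := hm (Fin.init ρ)
    simp only [cond_false]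
    linarith
  · exact SameProfile.of_atoms_eq (hm _) (hatoms _)

/-- Relatedness moves approximate solutions into one compact set, where the relaxed conditions `φ ≤
1 / (n + 1)` are closed and have the finite intersection property. -/
theorem exists_realization_one {k : ℕ} (a : Fin k → M) (Γ : Set (PrFormula (k + 1)))
    (h : ∀ Γ₀ : Finset (PrFormula (k + 1)), (Γ₀ : Set (PrFormula (k + 1))) ⊆ Γ →
      ∀ ε : ℝ, 0 < ε → ∃ c : M, ∀ φ ∈ Γ₀, (φ.eval (Fin.snoc a c : Fin (k + 1) → M) : ℝ) ≤ ε) :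
    ∃ c : M, ∀ φ ∈ Γ, φ.eval (Fin.snoc a c : Fin (k + 1) → M) = 0 := by
  classical
  obtain ⟨K, hK, hrel⟩ := exists_isCompact_rel a
  let t : Γ × ℕ → Set M := fun P =>
    {c | (P.1.1.eval (Fin.snoc a c : Fin (k + 1) → M) : ℝ) ≤ 1 / ((P.2 : ℝ) + 1)}
  have hsnoc : Continuous fun c : M => (Fin.snoc a c : Fin (k + 1) → M) := by
    refine continuous_pi fun i => ?_
    induction i using Fin.lastCases with
    | last => simpa using continuous_id'
    | cast i => simpa using continuous_const
  have hclosed : ∀ P, IsClosed (t P) := fun P =>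
    isClosed_le (continuous_subtype_val.comp ((uniformContinuous_eval P.1.1).continuous.comp hsnoc))
      continuous_const
  obtain ⟨c, -, hc⟩ := hK.inter_iInter_nonempty t hclosed fun w => by
    obtain ⟨c, hc⟩ := h (w.image fun P => P.1.1)
      (by
        intro φ hφ
        obtain ⟨P, -, rfl⟩ := Finset.mem_image.1 hφ
        exact P.1.2)
      (1 / (((w.sup Prod.snd : ℕ) : ℝ) + 1)) (by positivity)
    obtain ⟨k, hk, hck⟩ := hrel c
    refine ⟨k, hk, Set.mem_iInter₂.2 fun P hP => ?_⟩
    change (P.1.1.eval _ : ℝ) ≤ _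
    rw [← hck.eval_eq]
    exact (hc _ (Finset.mem_image_of_mem _ hP)).trans
      (Nat.one_div_le_one_div (Finset.le_sup (f := Prod.snd) hP))
  refine ⟨c, fun φ hφ => Subtype.ext (le_antisymm ?_ (φ.eval _).2.1)⟩
  exact ge_of_tendsto' tendsto_one_div_add_atTop_nhds_zero_nat fun n =>
    Set.mem_iInter.1 hc (⟨φ, hφ⟩, n)

/-- Induction on the number of variables. The first ones are chosen to satisfy every condition
saying that the infimum over the last variable of the maximum of a finite part of `Γ` is zero; the
last is then a one-variable problem over enlarged parameters. -/
theorem isOmegaSaturated (M : Type u) [PrStructure M] [IsProbAlg M] : IsOmegaSaturated M := by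
  classical
  intro k n
  induction n with
  | zero =>
    intro a Γ h
    refine ⟨Fin.elim0, fun φ hφ => Subtype.ext (le_antisymm ?_ (φ.eval _).2.1)⟩
    refine le_of_forall_pos_le_add fun ε hε => ?_
    obtain ⟨x, hx⟩ := h {φ} (by simpa using hφ) ε hε
    rw [Subsingleton.elim (Fin.elim0 : Fin 0 → M) x]
    simpa using hx φ (Finset.mem_singleton_self φ)
  | succ n ih =>
    intro a Γ h
    let Q (F : Finset (PrFormula (k + (n + 1)))) (χ : PrFormula (k + n)) : Prop :=
      (F : Set (PrFormula (k + (n + 1)))) ⊆ Γ ∧ ∃ ψ : PrFormula (k + n + 1), χ = .inf ψ ∧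
        ∀ (b : Fin (k + n + 1) → M) (r : I), ψ.eval b ≤ r ↔ ∀ φ ∈ F, φ.eval b ≤ r
    obtain ⟨x, hx⟩ := ih a {χ | ∃ F, Q F χ} fun Γ₀ hΓ₀ ε hε => by
      have hex : ∀ χ : PrFormula (k + n), ∃ F, χ ∈ Γ₀ → Q F χ := fun χ => by
        by_cases hχ : χ ∈ Γ₀
        · obtain ⟨F, hF⟩ := hΓ₀ hχ
          exact ⟨F, fun _ => hF⟩
        · exact ⟨∅, fun h => absurd h hχ⟩
      choose G hG using hex
      -- A single approximate solution serves all the finite sets at once. The tolerance is capped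
      -- at `1` so that it is an element of `I`.
      obtain ⟨x, hx⟩ := h (Γ₀.biUnion G) (fun φ hφ => by
        obtain ⟨χ, hχ, hφ⟩ := Finset.mem_biUnion.1 hφ
        exact (hG χ hχ).1 hφ) (min ε 1) (lt_min hε one_pos)
      refine ⟨Fin.init x, fun χ hχ => ?_⟩
      obtain ⟨-, ψ, rfl, hψ⟩ := hG χ hχ
      let r : I := ⟨min ε 1, (lt_min hε one_pos).le, min_le_right _ _⟩
      let y : Fin (k + n + 1) → M := (Fin.append a x : Fin (k + (n + 1)) → M)
      have hy : y = Fin.snoc (Fin.append a (Fin.init x)) (x (Fin.last n)) := by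
        rw [← Fin.append_snoc, Fin.snoc_init_self]
      have h1 : ψ.eval y ≤ r := (hψ y r).2 fun φ hφ =>
        hx φ (Finset.mem_biUnion.2 ⟨_, hχ, hφ⟩)
      rw [hy] at h1
      have h2 : (PrFormula.inf ψ).eval (Fin.append a (Fin.init x)) ≤ r :=
        (iInf_le (fun c : M => ψ.eval (Fin.snoc (Fin.append a (Fin.init x)) c)) _).trans h1
      exact (show ((PrFormula.inf ψ).eval (Fin.append a (Fin.init x)) : ℝ) ≤ min ε 1 from h2).trans
        (min_le_left _ _)
    obtain ⟨c, hc⟩ := exists_realization_one (Fin.append a x) Γ fun F hF ε hε => by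
      obtain ⟨ψ, hψ⟩ := PrFormula.exists_finset_max M F
      -- The infimum need not be attained, but its vanishing gives the approximate solutions that
      -- `exists_realization_one` asks for.
      have h0 : (PrFormula.inf ψ).eval (Fin.append a x) = 0 := hx _ ⟨F, hF, ψ, rfl, hψ⟩
      let r : I := ⟨min ε 1, (lt_min hε one_pos).le, min_le_right _ _⟩
      have hr : (⨅ c : M, ψ.eval (Fin.snoc (Fin.append a x) c)) < r := by
        change (PrFormula.inf ψ).eval (Fin.append a x) < r
        rw [h0]
        exact lt_min hε one_pos
      obtain ⟨c, hc⟩ := iInf_lt_iff.1 hr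
      exact ⟨c, fun φ hφ => (show (φ.eval _ : ℝ) ≤ min ε 1 from (hψ _ _).1 hc.le φ hφ).trans
        (min_le_left _ _)⟩
    refine ⟨Fin.snoc x c, fun φ hφ => ?_⟩
    rw [Fin.append_snoc]
    exact hc φ hφ

end Compactness

end ProbAlg

theorem corollary4p13 (T : PrTheory) (hT : IsCompletion.{u} Pr T) :
    IsSeparablyCategorical.{u} T ∧
    (∀ (M : Type u) [PrStructure M], IsModel M T → TopologicalSpace.SeparableSpace M →
      IsStronglyOmegaHomogeneous M) ∧
    (∀ (M : Type u) [PrStructure M], IsModel M T → IsOmegaSaturated M) := by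
  obtain ⟨hPr, ⟨M₀, _, hM₀⟩, hcomplete⟩ := hT
  have hprob : ∀ (M : Type u) [PrStructure M], IsModel M T → IsProbAlg M := fun M _ hM =>
    IsModel.isProbAlg fun φ hφ => hM φ (hPr hφ)
  refine ⟨⟨?_, fun M N _ _ hM hN hMs hNs => ?_⟩, fun M _ hM hMs n a b hab => ?_,
    fun M _ hM => ?_⟩
  · have := hprob M₀ hM₀
    obtain ⟨N, _, _, hN, hrel⟩ := ProbAlg.exists_separable_rel M₀
    exact ⟨N, inferInstance, fun φ hφ => (hrel.eval_eq φ).trans (hM₀ φ hφ), hN⟩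
  · have := hprob M hM
    have := hprob N hN
    -- Elementary equivalence says that the empty tuples of `M` and `N` satisfy the same formulas.
    obtain ⟨g, -⟩ := (ProbAlg.rel_of_eval_eq (hcomplete M N hM hN)).exists_prIso
    exact ⟨g⟩
  · have := hprob M hM
    exact (ProbAlg.rel_of_eval_eq hab).exists_prIso
  · have := hprob M hM
    exact ProbAlg.isOmegaSaturated M
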